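/- Let $\Gamma$ be an abelian group and $S\subseteq\Gamma$ a finite set. The Cayley graph $G(\Gamma,S)$ is the multigraph with vertex set $\Gamma$ and with one edge joining $x$ and $x+g$ for every pair $(x,g)\in\Gamma\times S$ (so if $g\neq -g$ and $g,-g\in S$, then $x$ and $x+g$ are joined by parallel edges). A double-ray is an infinite, connected, $2$-regular multigraph; a Hamiltonian double-ray of $G$ is a subgraph of $G$ which is a double-ray and contains every vertex of $G$. A Hamilton decomposition of $G$ is a set of Hamiltonian double-rays of $G$ such that every edge of $G$ lies in exactly one of them. A graph is one-ended if it has exactly one end. **Theorem.** Let $\Gamma$ be an infinite, finitely generated abelian group, and let $S$ be a finite generating set of $\Gamma$ such that every element of $S$ has infinite order. If the Cayley graph $G(\Gamma,S)$ is one-ended, then it has a Hamilton decomposition. Moreover, for every integer $n\geq 1$, the Cayley graph of $\mathbb{Z}^n$ with respect to the standard generating set $\{e_1,\dots,e_n\}$ has a Hamilton decomposition consisting of exactly $n$ Hamiltonian double-rays. -/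

import Mathlib

open scoped Graph

/-- The Cayley multigraph of an abelian group `Γ` with respect to a finite set `S`: its vertices are
the elements of `Γ`, and it has one edge `(x, g)`, joining `x` and `x + g`, for every `x : Γ` and
every `g ∈ S`. In particular, if both `g` and `-g` are in `S` (and `g ≠ -g`), then the edges `(x, g)`
and `(x + g, -g)` are different, parallel edges. -/
def cayleyMultigraph {Γ : Type*} [AddCommGroup Γ] (S : Finset Γ) : Graph Γ (Γ × Γ) where
  vertexSet := Set.univ
  IsLink e x y := e.2 ∈ S ∧ ((x = e.1 ∧ y = e.1 + e.2) ∨ (y = e.1 ∧ x = e.1 + e.2))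
  edgeSet := {e | e.2 ∈ S}
  isLink_symm := fun _ _ => ⟨fun _ _ h => ⟨h.1, h.2.symm⟩⟩
  eq_or_eq_of_isLink_of_isLink := by
    rintro e x y v w ⟨-, h⟩ ⟨-, h'⟩
    rcases h with ⟨rfl, rfl⟩ | ⟨rfl, rfl⟩ <;> rcases h' with ⟨rfl, rfl⟩ | ⟨rfl, rfl⟩ <;> simp
  edge_mem_iff_exists_isLink := fun e =>
    ⟨fun h => ⟨e.1, e.1 + e.2, h, Or.inl ⟨rfl, rfl⟩⟩, fun ⟨_, _, h⟩ => h.1⟩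
  left_mem_of_isLink := fun _ _ _ _ => Set.mem_univ _

/-- The degree of a vertex in a multigraph: the number of incident edges, loops counting twice. -/
noncomputable def multigraphDegree {α β : Type*} (G : Graph α β) (x : α) : ℕ∞ :=
  {e | G.IsNonloopAt e x}.encard + 2 * {e | G.IsLoopAt e x}.encard

/-- A multigraph is connected if its underlying simple graph is. -/
def IsConnectedMultigraph {α β : Type*} (G : Graph α β) : Prop :=
  G.toSimpleGraph.Connected

/-- A multigraph is one-ended if its underlying simple graph has exactly one end. -/
def IsOneEnded {α β : Type*} (G : Graph α β) : Prop :=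
  ∃! ε, ε ∈ G.toSimpleGraph.end

/-- A double-ray: an infinite, connected, 2-regular multigraph. -/
structure IsDoubleRay {α β : Type*} (R : Graph α β) : Prop where
  infinite : V(R).Infinite
  connected : IsConnectedMultigraph R
  two_regular : ∀ x ∈ V(R), multigraphDegree R x = 2

/-- A Hamiltonian double-ray of `G`: a subgraph of `G` which is a double-ray and which contains
every vertex of `G`. -/
structure IsHamiltonianDoubleRay {α β : Type*} (G R : Graph α β) : Prop where
  spanning : R ≤s G
  doubleRay : IsDoubleRay R

/-- A set `𝓓` of subgraphs of `G` is a Hamilton decomposition of `G` if its members are Hamiltonian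
double-rays of `G` and every edge of `G` belongs to exactly one of them. -/
structure IsHamiltonDecomposition {α β : Type*} (G : Graph α β) (𝓓 : Set (Graph α β)) : Prop where
  hamiltonian : ∀ R ∈ 𝓓, IsHamiltonianDoubleRay G R
  partition : ∀ e ∈ E(G), ∃! R, R ∈ 𝓓 ∧ e ∈ E(R)

/-- `G` has a Hamilton decomposition. -/
def HasHamiltonDecomposition {α β : Type*} (G : Graph α β) : Prop :=
  ∃ 𝓓 : Set (Graph α β), IsHamiltonDecomposition G 𝓓

/-- The standard generating set `{e₁, …, eₙ}` of `ℤⁿ`. -/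
def standardGenerators (n : ℕ) : Finset (Fin n → ℤ) :=
  Finset.univ.image fun i : Fin n => Pi.single i (1 : ℤ)

/-! Give the edge `(x, g)` the colour `g`. Each colour class is then 2-regular, but its components
are the cosets of ⟨g⟩, which form many double-rays. A Hamilton decomposition is a recolouring whose
classes remain 2-regular and become connected. It arises as a limit of finite modifications
(`exists_hamiltonian_colouring`): the countably many demands "v and w are joined in colour k" are
met one after another, and each time a joining path and all edges at v are frozen.

The basic modification exchanges the colours a and b on a square x, x + a, x + a + b, x + b, which
preserves 2-regularity. Every component of colour a keeps exactly two ends, so these components are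
encoded by a perfect matching M of the ends of the a-lines. A switch far out, at ends α and β of two
parallel lines on the same side, joins the two cut-off tails to each other and the two remaining
pieces to each other, so M becomes `rematch M α β` (`Represents.switchSquare`). The case M α = β is
excluded, since there the remaining piece would close up to a finite cycle. The square must also do
no harm in colour b; its position along the line is free, and this freedom suffices
(`exists_isMove`).

What remains is combinatorial (`joinable`): rematchings at equal sides of adjacent lines have to
bring the components of v and w together. When the graph of lines is bipartite, class and side split
the ends into two types, and matched ends always have opposite types. Each component therefore
offers an end of either type, so labels at odd distance can be chosen; they are moved together two
steps at a time, changing side on an unmodified line.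

One-endedness serves only to provide, for each a in S, some b in S independent of a. Otherwise Γ/⟨a⟩
is finite and a homomorphism to ℤ with finite fibres separates two ends
(`exists_hom_of_commensurable`, `not_isOneEnded_of_hom`). For ℤⁿ with n ≥ 2 such a b is visible, and
for n = 1 the standard colouring is already connected. -/

/-! ### Rematchings of an abstract set of ends -/

/-- A fixed-point-free involution, seen as a perfect matching of its domain. -/
structure IsMatchingMap {E : Type*} (M : E → E) : Prop where
  invol : ∀ α, M (M α) = α
  ne : ∀ α, M α ≠ α

open Classical in
/-- The matching obtained from `M` by matching `α` with `β`, and their former partners with each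
other. -/
noncomputable def rematch {E : Type*} (M : E → E) (α β γ : E) : E :=
  if γ = α then β else if γ = β then α else if γ = M α then M β else if γ = M β then M α else M γ

open Classical in
/-- The new label of a matched pair with label `γ` when passing from `M` to `rematch M α β`. -/
noncomputable def relabel {E : Type*} (M : E → E) (α β γ : E) : E :=
  -- After a switch, α and β are the ends of the joined tails. The vertices being tracked lie in the
  -- remaining pieces, whose ends are the former partners.
  if γ = α ∨ γ = β then M γ else γ

theorem IsMatchingMap.rematch {E : Type*} {M : E → E} (hM : IsMatchingMap M) {α β : E}
    (h : α ≠ β) (h' : M α ≠ β) : IsMatchingMap (rematch M α β) := by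
  have h1 := hM.invol
  have h2 := hM.ne
  constructor
  · intro γ
    have := h1 α; have := h1 β; have := h1 γ
    have := h2 α; have := h2 β; have := h2 γ
    unfold _root_.rematch
    grind
  · intro γ
    have := h1 α; have := h1 β; have := h1 γ
    have := h2 α; have := h2 β; have := h2 γ
    unfold _root_.rematch
    grind

theorem rematch_comm {E : Type*} {M : E → E} (hM : IsMatchingMap M) {α β : E}
    (h : α ≠ β) : rematch M α β = rematch M β α := by
  funext γ
  have := hM.invol α; have := hM.invol β; have := hM.ne α; have := hM.ne β
  unfold rematch
  grind

theorem relabel_comm {E : Type*} (M : E → E) (α β : E) : relabel M α β = relabel M β α := by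
  funext γ
  unfold relabel
  grind

/-- `Joinable A M p q` says that the matched pairs of `M` labelled by `p` and `q` can be joined by
successive rematchings at pairs of elements related by `A`. -/
inductive Joinable {E : Type*} (A : E → E → Prop) : (E → E) → E → E → Prop
  | refl (M : E → E) (p : E) : Joinable A M p p
  | flip_left {M : E → E} {p q : E} : Joinable A M (M p) q → Joinable A M p q
  | flip_right {M : E → E} {p q : E} : Joinable A M p (M q) → Joinable A M p q
  | step {M : E → E} {p q : E} (α β : E) : A α β → M α ≠ β →
      Joinable A (rematch M α β) (relabel M α β p) (relabel M α β q) → Joinable A M p q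

namespace Joinable

variable {E : Type*} {A : E → E → Prop} {M : E → E}

theorem symm {p q : E} (h : Joinable A M p q) : Joinable A M q p := by
  induction h with
  | refl M p => exact .refl M p
  | flip_left _ ih => exact .flip_right ih
  | flip_right _ ih => exact .flip_left ih
  | step α β hA hne _ ih => exact .step α β hA hne ih

/-- Rematching p with q makes their former partners partners of each other, and these carry the new
labels. -/
theorem of_adj (hM : IsMatchingMap M) {p q : E} (hpq : A p q) :
    Joinable A M p q := by
  by_cases h : M p = q
  · exact .flip_left (h ▸ .refl M _)
  · refine .step p q hpq h (.flip_left ?_)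
    have h1 := hM.ne p
    have : rematch M p q (relabel M p q p) = relabel M p q q := by
      unfold rematch relabel; grind
    rw [this]
    exact .refl _ _

/-- If b and d are partners, rematching a with b leaves the former partner of a matched with d.
Otherwise b and d are made partners beforehand. Either way the pair of a becomes the pair of d. The
clause on `M' γ` says that pairs disjoint from a, b, d survive, which `joinable_of_crossing` needs
for its unmodified line. -/
theorem two_step (hM : IsMatchingMap M) (hA : ∀ α β, A α β → α ≠ β) {a b d q : E} (hab : A a b)
    (hbd : A b d) (hqb : q ≠ b) (hqd : q ≠ d)
    (H : ∀ M', IsMatchingMap M' →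
      (∀ γ, γ ≠ a → γ ≠ b → γ ≠ d → M γ ≠ a → M γ ≠ b → M γ ≠ d → M' γ = M γ) →
      Joinable A M' d q) : Joinable A M a q := by
  have nab := hA _ _ hab
  have nbd := hA _ _ hbd
  have i := hM.invol
  have n := hM.ne
  have ia := i a; have ib := i b; have id := i d; have na := n a; have nb := n b; have nd := n d
  by_cases hqa : q = a
  · exact hqa ▸ .refl _ _
  by_cases hda : d = a
  · have := H M hM fun _ _ _ _ _ _ _ => rfl
    rwa [hda] at this
  by_cases hda' : d = M a
  · have := H M hM fun _ _ _ _ _ _ _ => rfl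
    exact .flip_left (by rwa [hda'] at this)
  by_cases hbd' : M b = d
  · have hne : M a ≠ b := by grind
    refine .step a b hab hne (.flip_left ?_)
    have e1 : rematch M a b (relabel M a b a) = d := by unfold rematch relabel; grind
    have e2 : relabel M a b q = q := by unfold relabel; grind
    rw [e1, e2]
    refine H _ (hM.rematch nab hne) fun γ _ _ _ _ _ _ => ?_
    have := i γ
    unfold rematch; grind
  · refine .step b d hbd hbd' ?_
    have hM1 := hM.rematch nbd hbd'
    have hne : rematch M b d a ≠ b := by unfold rematch; grind
    have e1 : relabel M b d a = a := by unfold relabel; grind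
    have e2 : relabel M b d q = q := by unfold relabel; grind
    rw [e1, e2]
    refine .step a b hab hne (.flip_left ?_)
    have hM2 := hM1.rematch nab hne
    have e2 : relabel (rematch M b d) a b q = q := by unfold relabel; grind
    have e3 : rematch M b d b = d := by unfold rematch; grind
    have e1 : rematch (rematch M b d) a b (relabel (rematch M b d) a b a) = d := by
      have e4 : relabel (rematch M b d) a b a = rematch M b d a := by simp [relabel]
      have e5 : rematch M b d a ≠ a := hM1.ne a
      rw [e4]
      rw [rematch, if_neg e5, if_neg hne, if_pos rfl, e3]
    rw [e1, e2]
    refine H _ hM2 fun γ _ _ _ _ _ _ => ?_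
    have := i γ
    have e5 : rematch M b d γ = M γ := by unfold rematch; grind
    have e6 := hM1.invol γ
    have e7 := hM1.invol a
    have e8 := hM1.invol b
    have e9 : γ ≠ rematch M b d a := by intro h; rw [← h] at e7; grind
    have e10 : γ ≠ rematch M b d b := by rw [e3]; assumption
    rw [rematch, if_neg ‹_›, if_neg ‹_›, if_neg e9, if_neg e10, e5]

end Joinable

/-! ### Walks between lines and the parity invariant -/

/-- The adjacency of the ends of lines: equal sides and adjacent lines. -/
def EndAdj {Q : Type*} (adj : Q → Q → Prop) (α β : Q × Bool) : Prop :=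
  adj α.1 β.1 ∧ α.2 = β.2

/-- `WalkOfLength adj n X Y`: there is a walk of length `n` from `X` to `Y`. -/
def WalkOfLength {Q : Type*} (adj : Q → Q → Prop) (n : ℕ) (X Y : Q) : Prop :=
  ∃ f : ℕ → Q, f 0 = X ∧ f n = Y ∧ ∀ k < n, adj (f k) (f (k + 1))

/-- Two ends are linked with parity `s` if the lines are joined by a walk whose length is congruent
to `s`, corrected by one if the sides are different. -/
def ParityLinked {Q : Type*} (adj : Q → Q → Prop) (s : Bool) (α β : Q × Bool) : Prop :=
  ∃ n, WalkOfLength adj n α.1 β.1 ∧ (Odd n ↔ (s ^^ (α.2 ^^ β.2)) = true)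

section Walks

variable {Q : Type*} {adj : Q → Q → Prop}

theorem WalkOfLength.single {X Y : Q} (h : adj X Y) : WalkOfLength adj 1 X Y :=
  ⟨fun n => if n = 0 then X else Y, by simp, by simp, by simpa⟩

theorem WalkOfLength.trans {m n : ℕ} {X Y Z : Q} (h : WalkOfLength adj m X Y)
    (h' : WalkOfLength adj n Y Z) : WalkOfLength adj (m + n) X Z := by
  obtain ⟨f, f0, fm, hf⟩ := h
  obtain ⟨g, g0, gn, hg⟩ := h'
  refine ⟨fun k => if k ≤ m then f k else g (k - m), by simp [f0], ?_, ?_⟩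
  · by_cases h : n = 0
    · subst h; simp [fm, ← gn, g0]
    · simp [h, gn]
  · intro k hk
    rcases lt_trichotomy k m with h | h | h
    · simpa [h.le, Nat.succ_le_of_lt h] using hf k h
    · subst h
      have := hg 0 (by omega)
      simpa [fm, ← g0] using this
    · have := hg (k - m) (by omega)
      simpa [h.not_ge, show ¬ k + 1 ≤ m by omega, show k + 1 - m = k - m + 1 by omega] using this

theorem WalkOfLength.symm (hs : ∀ X Y, adj X Y → adj Y X) {n : ℕ} {X Y : Q}
    (h : WalkOfLength adj n X Y) : WalkOfLength adj n Y X := by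
  obtain ⟨f, f0, fn, hf⟩ := h
  refine ⟨fun k => f (n - k), by simpa, by simpa, fun k hk => hs _ _ ?_⟩
  have := hf (n - (k + 1)) (by omega)
  rwa [show n - (k + 1) + 1 = n - k by omega] at this

theorem ParityLinked.symm (hs : ∀ X Y, adj X Y → adj Y X) {s : Bool} {α β : Q × Bool}
    (h : ParityLinked adj s α β) : ParityLinked adj s β α := by
  obtain ⟨n, hn, h⟩ := h
  exact ⟨n, hn.symm hs, by rw [h, Bool.xor_comm α.2]⟩

theorem ParityLinked.trans {s t : Bool} {α β γ : Q × Bool} (h : ParityLinked adj s α β)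
    (h' : ParityLinked adj t β γ) : ParityLinked adj (s ^^ t) α γ := by
  obtain ⟨n, hn, h⟩ := h
  obtain ⟨m, hm, h'⟩ := h'
  refine ⟨n + m, hn.trans hm, ?_⟩
  rw [Nat.odd_add, ← Nat.not_odd_iff_even, h, h']
  cases s <;> cases t <;> cases α.2 <;> cases β.2 <;> cases γ.2 <;> simp

theorem EndAdj.parityLinked {α β : Q × Bool} (h : EndAdj adj α β) :
    ParityLinked adj true α β :=
  ⟨1, .single h.1, by simp [h.2]⟩

/-- The former partners of α and β are linked through α and β by three odd links, whose total is odd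
again. -/
theorem ParityLinked.rematch (hs : ∀ X Y, adj X Y → adj Y X) {M : Q × Bool → Q × Bool}
    (hM : ∀ γ, ParityLinked adj true γ (M γ)) {α β : Q × Bool} (h : EndAdj adj α β)
    (γ : Q × Bool) : ParityLinked adj true γ (rematch M α β γ) := by
  have hαβ := h.parityLinked
  unfold _root_.rematch
  split_ifs with h1 h2 h3 h4
  · exact h1 ▸ hαβ
  · exact h2 ▸ hαβ.symm hs
  · exact h3 ▸ (((hM α).symm hs).trans hαβ).trans (hM β)
  · exact h4 ▸ (((hM β).symm hs).trans (hαβ.symm hs)).trans (hM α)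
  · exact hM γ

end Walks

/-! ### Joining any two labels by rematchings -/

section Joining

variable {Q : Type*} {adj : Q → Q → Prop} {M : Q × Bool → Q × Bool}

/-- `two_step` shortens the walk by two, and a walk of length one is `of_adj`. Oddness is what makes
the descent stop at length one. -/
theorem joinable_of_odd_walk (hs : ∀ X Y, adj X Y → adj Y X) (hi : ∀ X, ¬ adj X X) (n : ℕ) :
    ∀ {M : Q × Bool → Q × Bool}, IsMatchingMap M → Odd n → ∀ {X Y : Q}, WalkOfLength adj n X Y →
      ∀ s, Joinable (EndAdj adj) M (X, s) (Y, s) := by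
  have hA : ∀ α β : Q × Bool, EndAdj adj α β → α ≠ β := by
    rintro α _ h rfl
    exact hi _ h.1
  induction n using Nat.strong_induction_on with
  | _ n ih =>
  intro M hM hn X Y hw s
  obtain ⟨f, rfl, rfl, hf⟩ := hw
  have hsub : ∀ i j, i ≤ j → j ≤ n → WalkOfLength adj (j - i) (f i) (f j) := fun i j hij hj =>
    ⟨fun k => f (i + k), rfl, by simp [hij], fun k hk => hf _ (by omega)⟩
  have hadj : ∀ k < n, EndAdj adj (f k, s) (f (k + 1), s) := fun k hk => ⟨hf k hk, rfl⟩
  by_cases h1 : n = 1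
  · subst h1
    exact .of_adj hM (hadj 0 one_pos)
  obtain ⟨m, rfl⟩ := hn
  by_cases c1 : f (2 * m + 1) = f 1
  · rw [c1]; exact .of_adj hM (hadj 0 (by omega))
  -- `two_step` requires the target to differ from the two vertices passed. If the target is the
  -- third vertex, the walk is shortened from its other end; if that is blocked as well, the inner
  -- part of the walk already connects start and target.
  by_cases c2 : f (2 * m + 1) = f 2
  · by_cases c3 : f 0 = f (2 * m)
    · rw [c3]; exact .of_adj hM (hadj (2 * m) (by omega))
    by_cases c4 : f 0 = f (2 * m - 1)
    · by_cases c5 : m = 1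
      · subst c5
        exact absurd (c4 ▸ hf 0 (by omega)) (hi _)
      · rw [c2, c4]
        exact (ih (2 * m - 1 - 2) (by omega) hM ⟨m - 2, by omega⟩
          (hsub 2 (2 * m - 1) (by omega) (by omega)) s).symm
    · have a1 := hadj (2 * m) (by omega)
      have a2 := hadj (2 * m - 1) (by omega)
      rw [show 2 * m - 1 + 1 = 2 * m by omega] at a2
      refine (Joinable.two_step hM hA (b := (f (2 * m), s)) (d := (f (2 * m - 1), s))
        ⟨hs _ _ a1.1, rfl⟩ ⟨hs _ _ a2.1, rfl⟩ (by simpa) (by simpa) fun M' hM' _ => ?_).symm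
      exact (ih (2 * m - 1 - 0) (by omega) hM' ⟨m - 1, by omega⟩
          (hsub 0 (2 * m - 1) (by omega) (by omega)) s).symm
  · refine Joinable.two_step hM hA (hadj 0 (by omega)) (hadj 1 (by omega)) (by simpa) (by simpa)
      fun M' hM' _ => ?_
    exact ih (2 * m + 1 - 2) (by omega) hM' ⟨m - 1, by omega⟩
      (hsub 2 (2 * m + 1) (by omega) (by omega)) s

/-- Moving a label along an injective walk of odd length, one gains the other end of an unchanged
line. -/
theorem joinable_of_crossing (hi : ∀ X, ¬ adj X X) {q : Q × Bool} (n : ℕ) :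
    ∀ {M : Q × Bool → Q × Bool}, IsMatchingMap M → Odd n → ∀ {f : ℕ → Q}, Function.Injective f →
      (∀ k, adj (f k) (f (k + 1))) → ∀ s, q.2 = !s → M (f n, s) = (f n, !s) →
      (∀ M', IsMatchingMap M' → Joinable (EndAdj adj) M' (f n, !s) q) →
      Joinable (EndAdj adj) M (f 0, s) q := by
  have hA : ∀ α β : Q × Bool, EndAdj adj α β → α ≠ β := by
    rintro α _ h rfl
    exact hi _ h.1
  induction n using Nat.strong_induction_on with
  | _ n ih =>
  intro M hM hn f finj hf s hq hnorm H
  have hadj : ∀ k, EndAdj adj (f k, s) (f (k + 1), s) := fun k => ⟨hf k, rfl⟩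
  have hqs : ∀ X, q ≠ (X, s) := by
    rintro X rfl
    simp at hq
  by_cases h1 : n = 1
  · subst h1
    have hne : M (f 0, s) ≠ (f 1, s) := by
      intro h
      have := hM.invol (f 0, s)
      rw [h, hnorm] at this
      simp at this
    refine .step _ _ (hadj 0) hne (.flip_left ?_)
    have e2 : relabel M (f 0, s) (f (0 + 1), s) q = q := by
      simp [relabel, hqs]
    have e1 : relabel M (f 0, s) (f (0 + 1), s) (f 0, s) = M (f 0, s) := by simp [relabel]
    have e3 : rematch M (f 0, s) (f (0 + 1), s) (M (f 0, s)) = (f 1, !s) := by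
      rw [rematch, if_neg (hM.ne _), if_neg (by simpa using hne), if_pos rfl]
      simpa using hnorm
    rw [e2, e1, e3]
    exact H _ (hM.rematch (hA _ _ (hadj 0)) hne)
  · have h3 : 3 ≤ n := by obtain ⟨m, rfl⟩ := hn; omega
    refine Joinable.two_step hM hA (hadj 0) (hadj 1) (hqs _) (hqs _) fun M' hM' hpres => ?_
    have := ih (n - 2) (by omega) hM' (by obtain ⟨m, rfl⟩ := hn; exact ⟨m - 1, by omega⟩)
      (f := fun k => f (2 + k)) (fun a b h => by simpa using finj h) (fun k => hf (2 + k)) s hq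
    simp only [show 2 + (n - 2) = n by omega] at this
    refine this ?_ H
    have key : ∀ k, k < n → ∀ t, (f n, t) ≠ (f k, s) := by
      intro k hk t h
      have := finj (Prod.ext_iff.1 h).1
      omega
    rw [hpres] <;> first | exact hnorm | rw [hnorm] | skip
    all_goals apply key; omega

/-- For equal sides an odd walk suffices. For opposite sides, follow a ray to an unmodified line at
odd distance; one exists because only finitely many lines are modified. Cross there, and an odd walk
to the target remains. -/
theorem joinable (hs : ∀ X Y, adj X Y → adj Y X) (hi : ∀ X, ¬ adj X X)
    (hconn : ∀ X Y, ∃ n, WalkOfLength adj n X Y)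
    (hray : ∀ X, ∃ f : ℕ → Q, f 0 = X ∧ Function.Injective f ∧ ∀ k, adj (f k) (f (k + 1)))
    (hM : IsMatchingMap M) (hpar : ∀ γ, ParityLinked adj true γ (M γ))
    (hfin : {X | M (X, true) ≠ (X, false)}.Finite) (p q : Q × Bool) :
    Joinable (EndAdj adj) M p q := by
  have main : ∀ q, ParityLinked adj true p q → Joinable (EndAdj adj) M p q := by
    rintro ⟨Z, t⟩ hpq
    obtain ⟨X, s⟩ := p
    by_cases hst : t = s
    · subst hst
      obtain ⟨n, hw, hn⟩ := hpq
      exact joinable_of_odd_walk hs hi n hM (by simpa using hn) hw _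
    · obtain rfl : t = !s := Bool.eq_not.2 hst
      obtain ⟨f, rfl, finj, hf⟩ := hray X
      have : {n | M (f n, true) ≠ (f n, false)}.Finite := hfin.preimage finj.injOn
      have hodd : {n : ℕ | Odd n}.Infinite := by
        rw [← Nat.frequently_atTop_iff_infinite]; exact Nat.frequently_odd
      obtain ⟨n, hn, hnorm⟩ := (hodd.sdiff this).nonempty
      simp only [Set.mem_ofPred_eq, not_not] at hn hnorm
      have hnorm' : M (f n, s) = (f n, !s) := by
        cases s
        · rw [← hM.invol (f n, !false)]; simp [hnorm]
        · exact hnorm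
      refine joinable_of_crossing hi n hM hn finj hf s rfl hnorm' fun M' hM' => ?_
      have hw : ParityLinked adj true (f 0, s) (f n, s) :=
        ⟨n, ⟨f, rfl, rfl, fun k _ => hf k⟩, by simpa using hn⟩
      have hz := (hw.symm hs).trans hpq
      have hz' : ParityLinked adj true (f n, !s) (Z, !s) := by
        obtain ⟨m, hm, h⟩ := hz
        exact ⟨m, hm, by revert h; cases s <;> simp⟩
      obtain ⟨m, hm, h⟩ := hz'
      exact joinable_of_odd_walk hs hi m hM' (by simpa using h) hm _
  obtain ⟨n, hn⟩ := hconn p.1 q.1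
  -- If the walk has the wrong parity, q is replaced by its partner, which is linked to q with odd
  -- parity.
  by_cases h : (Odd n ↔ (true ^^ (p.2 ^^ q.2)) = true)
  · exact main q ⟨n, hn, h⟩
  · have h0 : ParityLinked adj false p q := by
      refine ⟨n, hn, ?_⟩
      revert h
      by_cases ho : Odd n <;> simp [ho]
    exact .flip_right (main _ (by simpa using h0.trans (hpar q)))

end Joining

/-! ### Connectivity under exchanging two links -/

/-- Replacing the links `x₀x₁`, `y₀y₁` by `x₀y₀`, `x₁y₁`, where `T` and `T'` are parts which are
attached to the rest at `x₁` and `y₁` only. -/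
theorem eqvGen_surgery {V : Type*} {r r' r₀ : V → V → Prop} {x₀ x₁ y₀ y₁ : V} {T T' : Set V}
    (hr₀ : ∀ u v, r u v → r₀ u v ∨ (u = x₀ ∧ v = x₁) ∨ (u = x₁ ∧ v = x₀) ∨ (u = y₀ ∧ v = y₁) ∨
      (u = y₁ ∧ v = y₀))
    (h₀r : ∀ u v, r₀ u v → r u v)
    (hr₀' : ∀ u v, r' u v → r₀ u v ∨ (u = x₀ ∧ v = y₀) ∨ (u = x₁ ∧ v = y₁))
    (h₀r' : ∀ u v, r₀ u v → r' u v) (hx' : r' x₀ y₀) (hy' : r' x₁ y₁)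
    (hT : ∀ u v, r₀ u v → (u ∈ T ↔ v ∈ T)) (hT' : ∀ u v, r₀ u v → (u ∈ T' ↔ v ∈ T'))
    (cT : ∀ u ∈ T, Relation.EqvGen r₀ x₁ u) (cT' : ∀ u ∈ T', Relation.EqvGen r₀ y₁ u)
    (hx₀ : x₀ ∉ T ∪ T') (hy₀ : y₀ ∉ T ∪ T') (hx₁ : x₁ ∈ T) (hy₁ : y₁ ∈ T') (hd : Disjoint T T')
    (u v : V) :
    Relation.EqvGen r' u v ↔ (u ∈ T ∪ T' ∧ v ∈ T ∪ T') ∨ (u ∉ T ∪ T' ∧ v ∉ T ∪ T' ∧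
      (Relation.EqvGen r u v ∨ (Relation.EqvGen r u x₀ ∧ Relation.EqvGen r v y₀) ∨
        (Relation.EqvGen r u y₀ ∧ Relation.EqvGen r v x₀))) := by
  have er := Relation.EqvGen.is_equivalence r
  have er' := Relation.EqvGen.is_equivalence r'
  constructor
  · intro h
    induction h with
    | rel u v h =>
      rcases hr₀' u v h with h | ⟨rfl, rfl⟩ | ⟨rfl, rfl⟩
      · have h1 := hT u v h
        have h2 := hT' u v h
        have h3 := Relation.EqvGen.rel _ _ (h₀r _ _ h)
        simp only [Set.mem_union, h1, h2]
        tauto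
      · exact .inr ⟨hx₀, hy₀, .inr (.inl ⟨er.refl _, er.refl _⟩)⟩
      · exact .inl ⟨.inl hx₁, .inr hy₁⟩
    | refl u =>
      have := er.refl u
      tauto
    | symm u v _ ih =>
      rcases ih with h | ⟨h1, h2, h⟩
      · exact .inl h.symm
      · refine .inr ⟨h2, h1, ?_⟩
        rcases h with h | h | h
        · exact .inl (er.symm h)
        · exact .inr (.inr h.symm)
        · exact .inr (.inl h.symm)
    | trans u v w _ _ ih ih' =>
      rcases ih with h | ⟨h1, h2, h⟩
      · rcases ih' with h' | h'
        · exact .inl ⟨h.1, h'.2⟩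
        · exact absurd h.2 h'.1
      · rcases ih' with h' | ⟨_, h3, h'⟩
        · exact absurd h'.1 h2
        · refine .inr ⟨h1, h3, ?_⟩
          rcases h with h | ⟨h, k⟩ | ⟨h, k⟩ <;> rcases h' with h' | ⟨h', k'⟩ | ⟨h', k'⟩
          · exact .inl (er.trans h h')
          · exact .inr (.inl ⟨er.trans h h', k'⟩)
          · exact .inr (.inr ⟨er.trans h h', k'⟩)
          · exact .inr (.inl ⟨h, er.trans (er.symm h') k⟩)
          · exact .inl (er.trans h (er.trans (er.symm h') (er.trans k (er.symm k'))))
          · exact .inl (er.trans h (er.symm k'))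
          · exact .inr (.inr ⟨h, er.trans (er.symm h') k⟩)
          · exact .inl (er.trans h (er.symm k'))
          · exact .inl (er.trans h (er.trans (er.symm h') (er.trans k (er.symm k'))))
  · have mono : ∀ u v, Relation.EqvGen r₀ u v → Relation.EqvGen r' u v :=
      fun u v => Relation.EqvGen.mono h₀r' u v
    have hx := Relation.EqvGen.rel _ _ hx'
    have hy := Relation.EqvGen.rel _ _ hy'
    rintro (⟨hu, hv⟩ | ⟨hu, hv, h⟩)
    · have key : ∀ u ∈ T ∪ T', Relation.EqvGen r' x₁ u := by
        rintro u (hu | hu)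
        · exact mono _ _ (cT u hu)
        · exact er'.trans hy (mono _ _ (cT' u hu))
      exact er'.trans (er'.symm (key u hu)) (key v hv)
    · classical
      -- Each tail is collapsed to the vertex outside it to which it was attached. This maps old
      -- connections to connections by `r'`, without using the removed links.
      let f : V → V := fun u => if u ∈ T then x₀ else if u ∈ T' then y₀ else u
      have fo : ∀ u, u ∉ T ∪ T' → f u = u := by
        intro u hu
        rw [Set.mem_union, not_or] at hu
        simp [f, hu]
      have fx₁ : f x₁ = x₀ := by simp [f, hx₁]
      have fy₁ : f y₁ = y₀ := by simp [f, hy₁, hd.notMem_of_mem_right hy₁]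
      have key : ∀ u v, Relation.EqvGen r u v → Relation.EqvGen r' (f u) (f v) := by
        intro u v h
        induction h with
        | rel u v h =>
          rcases hr₀ u v h with h | ⟨rfl, rfl⟩ | ⟨rfl, rfl⟩ | ⟨rfl, rfl⟩ | ⟨rfl, rfl⟩
          · have h1 := hT u v h
            have h2 := hT' u v h
            by_cases k1 : u ∈ T
            · simp only [f, k1, h1.1 k1, if_true]; exact er'.refl _
            · by_cases k2 : u ∈ T'
              · simp only [f, k1, k2, h2.1 k2, (not_congr h1).1 k1, if_true, if_false]
                exact er'.refl _
              · simp only [f, k1, k2, (not_congr h2).1 k2, (not_congr h1).1 k1, if_false]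
                exact .rel _ _ (h₀r' _ _ h)
          · rw [fx₁, fo _ hx₀]; exact er'.refl _
          · rw [fx₁, fo _ hx₀]; exact er'.refl _
          · rw [fy₁, fo _ hy₀]; exact er'.refl _
          · rw [fy₁, fo _ hy₀]; exact er'.refl _
        | refl u => exact er'.refl _
        | symm u v _ ih => exact er'.symm ih
        | trans u v w _ _ ih ih' => exact er'.trans ih ih'
      have fu := fo u hu
      have fv := fo v hv
      rcases h with h | ⟨h, h'⟩ | ⟨h, h'⟩
      · have := key _ _ h
        rwa [fu, fv] at this
      · have h1 := key _ _ h
        have h2 := key _ _ h'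
        rw [fu, fo _ hx₀] at h1
        rw [fv, fo _ hy₀] at h2
        exact er'.trans h1 (er'.trans hx (er'.symm h2))
      · have h1 := key _ _ h
        have h2 := key _ _ h'
        rw [fu, fo _ hy₀] at h1
        rw [fv, fo _ hx₀] at h2
        exact er'.trans h1 (er'.symm (er'.trans h2 hx))

/-! ### Colour classes and the ends of lines -/

section Colourings

variable {Γ : Type*} [AddCommGroup Γ]

/-- There is an edge of colour `k` from `u` to `v`. -/
def ColourStep (S : Finset Γ) (c : Γ × Γ → Γ) (k u v : Γ) : Prop :=
  ∃ g ∈ S, c (u, g) = k ∧ v = u + g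

/-- The vertices `u` and `v` are joined by edges of colour `k`. -/
def ColourConn (S : Finset Γ) (c : Γ × Γ → Γ) (k : Γ) : Γ → Γ → Prop :=
  Relation.EqvGen (ColourStep S c k)

theorem ColourConn.refl {S : Finset Γ} {c : Γ × Γ → Γ} {k : Γ} (u : Γ) : ColourConn S c k u u :=
  Relation.EqvGen.refl u

theorem ColourConn.symm {S : Finset Γ} {c : Γ × Γ → Γ} {k u v : Γ} (h : ColourConn S c k u v) :
    ColourConn S c k v u :=
  Relation.EqvGen.symm _ _ h

theorem ColourConn.trans {S : Finset Γ} {c : Γ × Γ → Γ} {k u v w : Γ} (h : ColourConn S c k u v)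
    (h' : ColourConn S c k v w) : ColourConn S c k u w :=
  Relation.EqvGen.trans _ _ _ h h'

theorem ColourConn.of_edge {S : Finset Γ} {c : Γ × Γ → Γ} {k u g : Γ} (hg : g ∈ S)
    (h : c (u, g) = k) : ColourConn S c k u (u + g) :=
  .rel _ _ ⟨g, hg, h, rfl⟩

/-- The two sides of `ℤ`. -/
noncomputable def sideFilter (s : Bool) : Filter ℤ := bif s then .atTop else .atBot

/-- The integer `n` lies at or beyond `m` on side `s`. -/
def Beyond (s : Bool) (m n : ℤ) : Prop := bif s then m ≤ n else n ≤ m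

instance (s : Bool) : (sideFilter s).NeBot := by
  cases s <;> simp only [sideFilter, cond_true, cond_false] <;> infer_instance

theorem eventually_beyond (s : Bool) (m : ℤ) : ∀ᶠ n in sideFilter s, Beyond s m n := by
  cases s
  · exact Filter.eventually_le_atBot m
  · exact Filter.eventually_ge_atTop m

theorem Beyond.refl (s : Bool) (m : ℤ) : Beyond s m m := by
  cases s <;> exact le_rfl

theorem eventually_sideFilter {s : Bool} {p : ℤ → Prop} :
    (∀ᶠ n in sideFilter s, p n) ↔ ∃ m, ∀ n, Beyond s m n → p n := by
  cases s
  · exact Filter.eventually_atBot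
  · exact Filter.eventually_atTop

theorem eventually_ne_sideFilter (s : Bool) (m : ℤ) : ∀ᶠ n in sideFilter s, n ≠ m := by
  cases s
  · exact Filter.eventually_ne_atBot m
  · exact Filter.eventually_ne_atTop m

theorem eventually_sideFilter_add {s : Bool} {p : ℤ → Prop} (k : ℤ) :
    (∀ᶠ n in sideFilter s, p (k + n)) ↔ ∀ᶠ n in sideFilter s, p n := by
  simp only [eventually_sideFilter]
  constructor
  · rintro ⟨m, h⟩
    refine ⟨k + m, fun n hn => ?_⟩
    have := h (n - k) (by cases s <;> simp only [Beyond, cond_true, cond_false] at * <;> omega)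
    simpa using this
  · rintro ⟨m, h⟩
    exact ⟨m - k, fun n hn =>
      h _ (by cases s <;> simp only [Beyond, cond_true, cond_false] at * <;> omega)⟩

/-- The ends of the lines in direction `a`. -/
abbrev LineEnd (a : Γ) : Type _ := (Γ ⧸ AddSubgroup.zmultiples a) × Bool

/-- The component of `v` in colour `a` contains the end `α`. -/
def Touches (S : Finset Γ) (c : Γ × Γ → Γ) (a v : Γ) (α : LineEnd a) : Prop :=
  ∀ᶠ n in sideFilter α.2, ColourConn S c a v (α.1.out + n • a)

theorem mk_eq_iff_exists {a x y : Γ} :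
    (x : Γ ⧸ AddSubgroup.zmultiples a) = y ↔ ∃ k : ℤ, y = x + k • a := by
  rw [QuotientAddGroup.eq, AddSubgroup.mem_zmultiples_iff]
  refine exists_congr fun k => ?_
  rw [eq_comm, neg_add_eq_iff_eq_add]

theorem touches_mk {S : Finset Γ} {c : Γ × Γ → Γ} {a v y : Γ} {s : Bool} :
    Touches S c a v ((y : Γ ⧸ AddSubgroup.zmultiples a), s) ↔
      ∀ᶠ n in sideFilter s, ColourConn S c a v (y + n • a) := by
  have : ((y : Γ ⧸ AddSubgroup.zmultiples a).out : Γ ⧸ AddSubgroup.zmultiples a) = y :=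
    Quotient.out_eq' _
  obtain ⟨k, hk⟩ := mk_eq_iff_exists.1 this
  unfold Touches
  generalize ((y : Γ ⧸ AddSubgroup.zmultiples a)).out = z at *
  subst hk
  rw [← eventually_sideFilter_add k]
  simp only [add_zsmul, add_assoc]

theorem zsmul_eq_zero_of_infinite {a : Γ} (ha : ¬ IsOfFinAddOrder a) {n : ℤ} (h : n • a = 0) :
    n = 0 := by
  by_contra hn
  exact ha (isOfFinAddOrder_iff_zsmul_eq_zero.2 ⟨n, hn, h⟩)

theorem zsmul_inj_of_infinite {a : Γ} (ha : ¬ IsOfFinAddOrder a) {n m : ℤ} (h : n • a = m • a) :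
    n = m :=
  sub_eq_zero.1 (zsmul_eq_zero_of_infinite ha (by rw [sub_smul, h]; abel))

/-- On each line, a finite set is avoided far out. -/
theorem eventually_beyond_notMem {a : Γ} (ha : ¬ IsOfFinAddOrder a) {B : Set Γ} (hB : B.Finite)
    (y : Γ) (s : Bool) : ∀ᶠ n in sideFilter s, ∀ m, Beyond s n m → y + m • a ∉ B := by
  have : ∀ᶠ n in sideFilter s, ∀ z ∈ B, ∀ m, Beyond s n m → y + m • a ≠ z := by
    rw [Filter.eventually_all_finite hB]
    intro z _
    by_cases h : ∃ k : ℤ, y + k • a = z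
    · obtain ⟨k, rfl⟩ := h
      filter_upwards [eventually_beyond s k, eventually_ne_sideFilter s k] with n hn hn' m hm h
      have := zsmul_inj_of_infinite ha (add_left_cancel h)
      subst this
      apply hn'
      cases s
      · exact le_antisymm hn hm
      · exact le_antisymm hm hn
    · push Not at h
      exact .of_forall fun n m _ => h m
  filter_upwards [this] with n hn m hm hmB
  exact hn _ hmB m hm rfl

/-- The vertices incident with the edges in a set. -/
def edgeEnds (F : Set (Γ × Γ)) : Set Γ := Prod.fst '' F ∪ (fun e => e.1 + e.2) '' F

theorem Set.Finite.edgeEnds {F : Set (Γ × Γ)} (hF : F.Finite) : (edgeEnds F).Finite :=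
  (hF.image _).union (hF.image _)

theorem notMem_of_fst_notMem_edgeEnds {F : Set (Γ × Γ)} {u g : Γ} (h : u ∉ edgeEnds F) :
    (u, g) ∉ F :=
  fun h' => h (.inl ⟨_, h', rfl⟩)

theorem notMem_of_snd_notMem_edgeEnds {F : Set (Γ × Γ)} {u g : Γ} (h : u + g ∉ edgeEnds F) :
    (u, g) ∉ F :=
  fun h' => h (.inr ⟨_, h', rfl⟩)

theorem colourConn_line {S : Finset Γ} {c : Γ × Γ → Γ} {a y : Γ} (ha : a ∈ S) {m n : ℤ}
    (hmn : m ≤ n) (h : ∀ k, m ≤ k → k < n → c (y + k • a, a) = a) :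
    ColourConn S c a (y + m • a) (y + n • a) := by
  induction n, hmn using Int.leInduction with
  | base => exact .refl _
  | succ n hmn ih =>
    refine (ih fun k hk hk' => h k hk (by omega)).trans ?_
    rw [add_zsmul, one_zsmul, ← add_assoc]
    exact .of_edge ha (h n hmn (by omega))

theorem eventually_colourConn_beyond {S : Finset Γ} {c : Γ × Γ → Γ} (hc : {e | c e ≠ e.2}.Finite)
    {a : Γ} (haS : a ∈ S) (ha : ¬ IsOfFinAddOrder a) (y : Γ) (s : Bool) :
    ∀ᶠ n in sideFilter s, ∀ m, Beyond s n m → ColourConn S c a (y + n • a) (y + m • a) := by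
  filter_upwards [eventually_beyond_notMem ha hc.edgeEnds y s] with n hn m hm
  have h : ∀ k, Beyond s n k → c (y + k • a, a) = a := fun k hk => by
    simpa using notMem_of_fst_notMem_edgeEnds (g := a) (hn k hk)
  cases s
  · exact (colourConn_line haS hm fun k _ hk => h k hk.le).symm
  · exact colourConn_line haS hm fun k hk _ => h k hk

/-- Far out the line is unmodified, hence connected in colour a. The choice of n is uniform in v, so
one far vertex can stand for the end. -/
theorem eventually_touches_iff {S : Finset Γ} {c : Γ × Γ → Γ} (hc : {e | c e ≠ e.2}.Finite)
    {a : Γ} (haS : a ∈ S) (ha : ¬ IsOfFinAddOrder a) (y : Γ) (s : Bool) :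
    ∀ᶠ n in sideFilter s, ∀ v, Touches S c a v ((y : Γ ⧸ AddSubgroup.zmultiples a), s) ↔
      ColourConn S c a v (y + n • a) := by
  filter_upwards [eventually_colourConn_beyond hc haS ha y s] with n hn v
  rw [touches_mk]
  constructor
  · intro h
    obtain ⟨m, hm, hm'⟩ := (h.and (eventually_beyond s n)).exists
    exact hm.trans (hn m hm').symm
  · intro h
    filter_upwards [eventually_beyond s n] with m hm
    exact h.trans (hn m hm)

/-- The part of the line through `x` in direction `a` which lies beyond the edge `(x, a)`. -/
def lineTail (x a : Γ) (s : Bool) : Set Γ :=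
  -- The edge `(x, a)` occupies positions 0 and 1 of the line; removing it leaves the halves m ≥ 1
  -- and m ≤ 0.
  {z | ∃ m : ℤ, z = x + m • a ∧ bif s then 1 ≤ m else m ≤ 0}

theorem eventually_mem_lineTail_iff {a : Γ} (ha : ¬ IsOfFinAddOrder a) (x y : Γ) (s t : Bool) :
    ∀ᶠ n in sideFilter t, (y + n • a ∈ lineTail x a s ↔
      (((y : Γ ⧸ AddSubgroup.zmultiples a), t) : LineEnd a) = (↑x, s)) := by
  by_cases h : (x : Γ ⧸ AddSubgroup.zmultiples a) = y
  · obtain ⟨k, rfl⟩ := mk_eq_iff_exists.1 h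
    have : ∀ n : ℤ, x + k • a + n • a ∈ lineTail x a s ↔ bif s then 1 ≤ k + n else k + n ≤ 0 := by
      intro n
      rw [add_assoc, ← add_zsmul]
      constructor
      · rintro ⟨m, hm, hm'⟩
        rwa [zsmul_inj_of_infinite ha (add_left_cancel hm)]
      · exact fun h => ⟨_, rfl, h⟩
    simp only [this, ← h, Prod.mk.injEq, true_and]
    rw [eventually_sideFilter_add (p := fun n => (bif s then 1 ≤ n else n ≤ 0) ↔ t = s) k]
    cases t <;> cases s <;> simp only [cond_true, cond_false, iff_true, reduceCtorEq, iff_false]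
    · exact Filter.eventually_le_atBot 0
    · filter_upwards [Filter.eventually_le_atBot (0 : ℤ)] with n hn using by omega
    · filter_upwards [Filter.eventually_ge_atTop (1 : ℤ)] with n hn using by omega
    · exact Filter.eventually_ge_atTop 1
  · refine .of_forall fun n => iff_of_false ?_ fun h' => h (Prod.ext_iff.1 h').1.symm
    rintro ⟨m, hm, -⟩
    refine h (mk_eq_iff_exists.2 ⟨m - n, ?_⟩)
    rw [eq_sub_of_add_eq hm, sub_smul, add_sub_assoc]

end Colourings

/-! ### Switching a square and its effect on components -/

section Switching

variable {Γ : Type*} [AddCommGroup Γ]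

open Classical in
/-- Exchange the colours `a` and `b` on the edges of the square `x, x + a, x + a + b, x + b`. -/
noncomputable def switchSquare (c : Γ × Γ → Γ) (x a b : Γ) (e : Γ × Γ) : Γ :=
  if e = (x, a) ∨ e = (x + b, a) then b else if e = (x, b) ∨ e = (x + a, b) then a else c e

theorem switchSquare_comm (c : Γ × Γ → Γ) (x : Γ) {a b : Γ} (hab : a ≠ b) :
    switchSquare c x a b = switchSquare c x b a := by
  funext e
  unfold switchSquare
  have h : ∀ u v : Γ, (u, a) ≠ (v, b) := fun u v h => hab (Prod.ext_iff.1 h).2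
  by_cases h1 : e = (x, a) ∨ e = (x + b, a)
  · have : ¬ (e = (x, b) ∨ e = (x + a, b)) := by
      rintro (h2 | h2) <;> rcases h1 with h1 | h1 <;> exact h _ _ (h1.symm.trans h2)
    simp only [h1, this, if_true, if_false]
  · simp only [h1, if_false]

/-- The edges of the square are coloured in the standard way. -/
structure IsStandardSquare (c : Γ × Γ → Γ) (x a b : Γ) : Prop where
  left : c (x, a) = a
  left' : c (x + b, a) = a
  right : c (x, b) = b
  right' : c (x + a, b) = b

theorem IsStandardSquare.symm {c : Γ × Γ → Γ} {x a b : Γ} (h : IsStandardSquare c x a b) :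
    IsStandardSquare c x b a :=
  ⟨h.3, h.4, h.1, h.2⟩

/-- A matching of the ends of the lines in direction `a` which describes the components of
colour `a`. -/
structure Represents (S : Finset Γ) (c : Γ × Γ → Γ) (a : Γ) (M : LineEnd a → LineEnd a) :
    Prop where
  matching : IsMatchingMap M
  exists_touches_iff : ∀ v, ∃ p, ∀ γ, Touches S c a v γ ↔ γ = p ∨ γ = M p

/-- Around the tail the only edges of colour a are those of the line, and the single one leaving the
tail is `(z, a)`. -/
theorem lineTail_iff_of_step {S : Finset Γ} {c : Γ × Γ → Γ} {a z : Γ} {s : Bool}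
    (hstd : ∀ u g, u ∈ lineTail z a s ∨ u + g ∈ lineTail z a s → c (u, g) = a → g = a)
    (hz : c (z, a) ≠ a) {u v : Γ} (h : ColourStep S c a u v) :
    u ∈ lineTail z a s ↔ v ∈ lineTail z a s := by
  obtain ⟨g, _, hc, rfl⟩ := h
  constructor
  · intro hu
    obtain rfl := hstd u g (.inl hu) hc
    obtain ⟨m, rfl, hm⟩ := hu
    have : m ≠ 0 := by
      rintro rfl
      simp at hc
      exact hz hc
    refine ⟨m + 1, by rw [add_zsmul, one_zsmul, add_assoc], ?_⟩
    cases s <;> simp only [cond_true, cond_false] at * <;> omega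
  · intro hu
    obtain rfl := hstd u g (.inr hu) hc
    obtain ⟨m, hm', hm⟩ := hu
    obtain rfl : u = z + (m - 1) • g := by
      rw [sub_smul, one_zsmul, ← add_sub_assoc, ← hm', add_sub_cancel_right]
    have : m ≠ 1 := by
      rintro rfl
      simp at hc
      exact hz hc
    refine ⟨m - 1, rfl, ?_⟩
    cases s <;> simp only [cond_true, cond_false] at * <;> omega

theorem disjoint_lineTail {a b : Γ} (hab : b ∉ AddSubgroup.zmultiples a) (x : Γ) (s : Bool) :
    Disjoint (lineTail x a s) (lineTail (x + b) a s) := by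
  rw [Set.disjoint_left]
  rintro z ⟨m, rfl, -⟩ ⟨n, hn, -⟩
  refine hab (AddSubgroup.mem_zmultiples_iff.2 ⟨m - n, ?_⟩)
  rw [add_assoc] at hn
  rw [sub_smul, add_left_cancel hn, add_sub_cancel_right]

/-- An instance of `eqvGen_surgery`: the two a-edges of the square are replaced by its two b-edges,
and the tails T, T' are the unmodified halves of the two lines beyond it. -/
theorem colourConn_switchSquare {S : Finset Γ} {c : Γ × Γ → Γ} {x a b : Γ} (haS : a ∈ S)
    (hbS : b ∈ S) (ha : ¬ IsOfFinAddOrder a) (hab : b ∉ AddSubgroup.zmultiples a)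
    (hsq : IsStandardSquare c x a b) {s : Bool}
    (hstd : ∀ u g, u ∈ lineTail x a s ∪ lineTail (x + b) a s ∨
      u + g ∈ lineTail x a s ∪ lineTail (x + b) a s → c (u, g) = g) (u v : Γ) :
    ColourConn S (switchSquare c x a b) a u v ↔
      (u ∈ lineTail x a s ∪ lineTail (x + b) a s ∧ v ∈ lineTail x a s ∪ lineTail (x + b) a s) ∨
      (u ∉ lineTail x a s ∪ lineTail (x + b) a s ∧ v ∉ lineTail x a s ∪ lineTail (x + b) a s ∧
        (ColourConn S c a u v ∨ (ColourConn S c a u x ∧ ColourConn S c a v (x + b)) ∨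
        (ColourConn S c a u (x + b) ∧ ColourConn S c a v x))) := by
  classical
  have hne : b ≠ a := by rintro rfl; exact hab (AddSubgroup.mem_zmultiples b)
  have ha0 : a ≠ 0 := by rintro rfl; exact ha .zero
  -- The common part of the old and new classes. The value 0 just means "not a", as a ≠ 0 by
  -- infinite order.
  set c₀ : Γ × Γ → Γ := fun e => if e = (x, a) ∨ e = (x + b, a) then 0 else c e with hc₀
  have h₀ : ∀ u g, c₀ (u, g) = a ↔ c (u, g) = a ∧ (u, g) ≠ (x, a) ∧ (u, g) ≠ (x + b, a) := by
    intro u g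
    simp only [hc₀]
    split_ifs with h
    · simp only [ha0.symm, false_iff]; tauto
    · tauto
  have hsw : ∀ u g, switchSquare c x a b (u, g) = a ↔
      c₀ (u, g) = a ∨ (u, g) = (x, b) ∨ (u, g) = (x + a, b) := by
    intro u g
    have hcb : c (x, b) ≠ a := by rw [hsq.right]; exact hne
    have hcb' : c (x + a, b) ≠ a := by rw [hsq.right']; exact hne
    have : ∀ u v : Γ, (u, a) ≠ (v, b) := fun u v h => hne (Prod.ext_iff.1 h).2.symm
    rw [h₀]
    unfold switchSquare
    split_ifs with h1 h2
    · simp only [hne, false_iff]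
      rcases h1 with h1 | h1 <;> simp [h1, hne.symm]
    · simp only [h2, or_true]
    · tauto
  have key : ∀ z, z = x ∨ z = x + b → ∀ u g,
      u ∈ lineTail z a s ∨ u + g ∈ lineTail z a s → c₀ (u, g) = a → g = a := by
    intro z hz u g h hc
    rw [← hstd u g, ((h₀ u g).1 hc).1]
    rcases hz with rfl | rfl <;> simp only [Set.mem_union] <;> tauto
  have hnot : ∀ z, z = x ∨ z = x + b → c₀ (z, a) ≠ a := by
    rintro z (rfl | rfl) <;> simp [hc₀, ha0.symm]
  have conn : ∀ z, z = x ∨ z = x + b → ∀ m n : ℤ, m ≤ n →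
      (∀ k, m ≤ k → k < n → k ≠ 0 ∧ z + k • a ∈ lineTail z a s) →
      ColourConn S c₀ a (z + m • a) (z + n • a) := by
    intro z hz m n hmn h
    refine colourConn_line haS hmn fun k hk hk' => ?_
    obtain ⟨h1, h2⟩ := h k hk hk'
    refine (h₀ _ _).2 ⟨hstd _ _ (.inl ?_), ?_, ?_⟩
    · rcases hz with rfl | rfl
      · exact .inl h2
      · exact .inr h2
    · intro h
      rw [Prod.mk.injEq] at h
      rcases hz with rfl | rfl
      · exact h1 (zsmul_eq_zero_of_infinite ha (by simpa using h.1))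
      · refine hab (AddSubgroup.mem_zmultiples_iff.2 ⟨-k, ?_⟩)
        have := h.1
        rw [add_assoc, add_eq_left] at this
        rw [neg_zsmul]
        exact (eq_neg_of_add_eq_zero_left this).symm
    · intro h
      rw [Prod.mk.injEq] at h
      rcases hz with rfl | rfl
      · exact hab (AddSubgroup.mem_zmultiples_iff.2 ⟨k, add_left_cancel h.1⟩)
      · exact h1 (zsmul_eq_zero_of_infinite ha (by simpa using h.1))
  have hx : ColourStep S c a x (x + a) := ⟨a, haS, hsq.left, rfl⟩
  have hy : ColourStep S c a (x + b) (x + b + a) := ⟨a, haS, hsq.left', rfl⟩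
  have hr₀ : ∀ u v, ColourStep S c a u v → ColourStep S c₀ a u v ∨ (u = x ∧ v = x + a) ∨
      (u = x + b ∧ v = x + b + a) := by
    rintro u v ⟨g, hg, hc, rfl⟩
    by_cases h1 : (u, g) = (x, a)
    · rw [Prod.mk.injEq] at h1
      obtain ⟨rfl, rfl⟩ := h1
      simp
    by_cases h2 : (u, g) = (x + b, a)
    · rw [Prod.mk.injEq] at h2
      obtain ⟨rfl, rfl⟩ := h2
      simp
    exact .inl ⟨g, hg, (h₀ _ _).2 ⟨hc, h1, h2⟩, rfl⟩
  have h₀r : ∀ u v, ColourStep S c₀ a u v → ColourStep S c a u v := by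
    rintro u v ⟨g, hg, hc, rfl⟩
    exact ⟨g, hg, ((h₀ _ _).1 hc).1, rfl⟩
  have hr₀' : ∀ u v, ColourStep S (switchSquare c x a b) a u v → ColourStep S c₀ a u v ∨
      (u = x ∧ v = x + b) ∨ (u = x + a ∧ v = x + b + a) := by
    rintro u v ⟨g, hg, hc, rfl⟩
    rcases (hsw _ _).1 hc with h | h | h
    · exact .inl ⟨g, hg, h, rfl⟩
    · rw [Prod.mk.injEq] at h
      obtain ⟨rfl, rfl⟩ := h
      simp
    · rw [Prod.mk.injEq] at h
      obtain ⟨rfl, rfl⟩ := h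
      simp [add_right_comm]
  have h₀r' : ∀ u v, ColourStep S c₀ a u v → ColourStep S (switchSquare c x a b) a u v := by
    rintro u v ⟨g, hg, hc, rfl⟩
    exact ⟨g, hg, (hsw _ _).2 (.inl hc), rfl⟩
  have hx' : ColourStep S (switchSquare c x a b) a x (x + b) :=
    ⟨b, hbS, (hsw _ _).2 (by simp), rfl⟩
  have hy' : ColourStep S (switchSquare c x a b) a (x + a) (x + b + a) :=
    ⟨b, hbS, (hsw _ _).2 (by simp), add_right_comm _ _ _⟩
  have hT : ∀ z, z = x ∨ z = x + b → ∀ u v, ColourStep S c₀ a u v →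
      (u ∈ lineTail z a s ↔ v ∈ lineTail z a s) :=
    fun z hz u v => lineTail_iff_of_step (key z hz) (hnot z hz)
  have hd := disjoint_lineTail hab x s
  have notmem : ∀ m : ℤ, ¬ (bif s then 1 ≤ m else m ≤ 0) →
      x + m • a ∉ lineTail x a s ∪ lineTail (x + b) a s ∧
      x + b + m • a ∉ lineTail x a s ∪ lineTail (x + b) a s := by
    intro m hm
    refine ⟨?_, ?_⟩
    · rintro (⟨k, hk, hk'⟩ | ⟨k, hk, hk'⟩)
      · rw [zsmul_inj_of_infinite ha (add_left_cancel hk)] at hm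
        exact hm hk'
      · rw [add_assoc] at hk
        refine hab (AddSubgroup.mem_zmultiples_iff.2 ⟨m - k, ?_⟩)
        rw [sub_smul, add_left_cancel hk, add_sub_cancel_right]
    · rintro (⟨k, hk, hk'⟩ | ⟨k, hk, hk'⟩)
      · rw [add_assoc] at hk
        refine hab (AddSubgroup.mem_zmultiples_iff.2 ⟨k - m, ?_⟩)
        rw [sub_smul, ← add_left_cancel hk, add_sub_cancel_right]
      · rw [zsmul_inj_of_infinite ha (add_left_cancel hk)] at hm
        exact hm hk'
  have e := Relation.EqvGen.is_equivalence (ColourStep S c a)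
  have cx : ∀ u, ColourConn S c a u (x + a) ↔ ColourConn S c a u x := fun u =>
    ⟨fun h => e.trans h (e.symm (.rel _ _ hx)), fun h => e.trans h (.rel _ _ hx)⟩
  have cy : ∀ u, ColourConn S c a u (x + b + a) ↔ ColourConn S c a u (x + b) := fun u =>
    ⟨fun h => e.trans h (e.symm (.rel _ _ hy)), fun h => e.trans h (.rel _ _ hy)⟩
  cases s
  · have := eqvGen_surgery (x₀ := x + a) (x₁ := x) (y₀ := x + b + a) (y₁ := x + b)
      (fun u v h => by have := hr₀ u v h; tauto) h₀r (fun u v h => by have := hr₀' u v h; tauto)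
      h₀r' hy' hx' (hT x (.inl rfl)) (hT (x + b) (.inr rfl))
      (by
        rintro _ ⟨m, rfl, hm : m ≤ 0⟩
        have := conn x (.inl rfl) m 0 hm fun k _ hk' => ⟨hk'.ne, k, rfl, hk'.le⟩
        rw [zero_zsmul, add_zero] at this
        exact this.symm)
      (by
        rintro _ ⟨m, rfl, hm : m ≤ 0⟩
        have := conn (x + b) (.inr rfl) m 0 hm fun k _ hk' => ⟨hk'.ne, k, rfl, hk'.le⟩
        rw [zero_zsmul, add_zero] at this
        exact this.symm)
      (by simpa using (notmem 1 (by simp)).1) (by simpa using (notmem 1 (by simp)).2)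
      ⟨0, by simp, le_rfl⟩ ⟨0, by simp, le_rfl⟩ hd u v
    refine this.trans ?_
    have c1 := cx u; have c2 := cx v; have c3 := cy u; have c4 := cy v
    unfold ColourConn at *
    rw [c1, c2, c3, c4]
  · exact eqvGen_surgery (x₀ := x) (x₁ := x + a) (y₀ := x + b) (y₁ := x + b + a)
      (fun u v h => by have := hr₀ u v h; tauto) h₀r (fun u v h => by have := hr₀' u v h; tauto)
      h₀r' hx' hy' (hT x (.inl rfl)) (hT (x + b) (.inr rfl))
      (by
        rintro _ ⟨m, rfl, hm : 1 ≤ m⟩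
        have := conn x (.inl rfl) 1 m hm fun k hk _ => ⟨by omega, k, rfl, hk⟩
        rwa [one_zsmul] at this)
      (by
        rintro _ ⟨m, rfl, hm : 1 ≤ m⟩
        have := conn (x + b) (.inr rfl) 1 m hm fun k hk _ => ⟨by omega, k, rfl, hk⟩
        rwa [one_zsmul] at this)
      (by simpa using (notmem 0 (by simp)).1) (by simpa using (notmem 0 (by simp)).2)
      ⟨1, by simp, le_rfl⟩ ⟨1, by simp, le_rfl⟩ hd u v

theorem finite_ne_switchSquare {c : Γ × Γ → Γ} (hc : {e | c e ≠ e.2}.Finite) (x a b : Γ) :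
    {e | switchSquare c x a b e ≠ e.2}.Finite := by
  refine (hc.union (Set.toFinite {(x, a), (x + b, a), (x, b), (x + a, b)})).subset fun e he => ?_
  by_cases h : e = (x, a) ∨ e = (x + b, a) ∨ e = (x, b) ∨ e = (x + a, b)
  · exact .inr (by simpa using h)
  · left
    have : switchSquare c x a b e = c e := by
      unfold switchSquare
      rw [if_neg (by tauto), if_neg (by tauto)]
    simpa [this] using he

/-- Switching a square far out on the side `s` rematches the ends of its two lines. -/
theorem Represents.switchSquare {S : Finset Γ} {c : Γ × Γ → Γ} {x a b : Γ} (haS : a ∈ S)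
    (hbS : b ∈ S) (ha : ¬ IsOfFinAddOrder a) (hab : b ∉ AddSubgroup.zmultiples a)
    (hfin : {e | c e ≠ e.2}.Finite) (hsq : IsStandardSquare c x a b) {s : Bool}
    (hstd : ∀ u g, u ∈ lineTail x a s ∪ lineTail (x + b) a s ∨
      u + g ∈ lineTail x a s ∪ lineTail (x + b) a s → c (u, g) = g)
    {M : LineEnd a → LineEnd a} (hM : Represents S c a M) (hne : M (↑x, s) ≠ (↑(x + b), s)) :
    Represents S (switchSquare c x a b) a (rematch M (↑x, s) (↑(x + b), s)) ∧
      ∀ v ∉ lineTail x a s ∪ lineTail (x + b) a s, ∀ γ, Touches S c a v γ →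
        Touches S (_root_.switchSquare c x a b) a v (relabel M (↑x, s) (↑(x + b), s) γ) := by
  have hconn := colourConn_switchSquare haS hbS ha hab hsq hstd
  have hneq : (x : Γ ⧸ AddSubgroup.zmultiples a) ≠ ↑(x + b) := by
    intro h
    obtain ⟨k, hk⟩ := mk_eq_iff_exists.1 h
    exact hab (AddSubgroup.mem_zmultiples_iff.2 ⟨k, (add_left_cancel hk).symm⟩)
  set c' := _root_.switchSquare c x a b with hc'
  set U := lineTail x a s ∪ lineTail (x + b) a s with hU
  set α : LineEnd a := (↑x, s) with hα
  set β : LineEnd a := (↑(x + b), s) with hβ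
  have hαβ : α ≠ β := fun h => hneq (Prod.ext_iff.1 h).1
  -- Each end is replaced by one vertex far enough out to represent it both before and after the
  -- switch, so that `hconn` decides all incidences.
  have hz : ∀ γ : LineEnd a, ∃ z, (z ∈ U ↔ γ = α ∨ γ = β) ∧
      (∀ v, Touches S c a v γ ↔ ColourConn S c a v z) ∧
      (∀ v, Touches S c' a v γ ↔ ColourConn S c' a v z) := by
    rintro ⟨Y, t⟩
    induction Y using QuotientAddGroup.induction_on with
    | H y =>
    obtain ⟨n, h1, h2, h3, h4⟩ := ((eventually_mem_lineTail_iff ha x y s t).and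
      ((eventually_mem_lineTail_iff ha (x + b) y s t).and
      ((eventually_touches_iff hfin haS ha y t).and
      (eventually_touches_iff (finite_ne_switchSquare hfin x a b) haS ha y t)))).exists
    exact ⟨y + n • a, by rw [hU, Set.mem_union, h1, h2], h3, h4⟩
  choose z hzU hz hz' using hz
  have hx : Touches S c a x α ∧ Touches S c a (x + b) β := by
    rw [hα, hβ, touches_mk, touches_mk]
    have hline : ∀ w ∈ ({x, x + b} : Set Γ), c (w, a) = a ∧ lineTail w a s ⊆ U := by
      rintro w (rfl | rfl)
      · exact ⟨hsq.left, Set.subset_union_left⟩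
      · exact ⟨hsq.left', Set.subset_union_right⟩
    have : ∀ w ∈ ({x, x + b} : Set Γ), ∀ᶠ n in sideFilter s, ColourConn S c a w (w + n • a) := by
      intro w hw
      obtain ⟨h1, h2⟩ := hline w hw
      filter_upwards [eventually_beyond s 0] with n hn
      cases s
      · have := colourConn_line (S := S) (c := c) (y := w) haS hn fun k _ hk =>
          hstd _ _ (.inl (h2 ⟨k, rfl, hk.le⟩))
        rw [zero_zsmul, add_zero] at this
        exact this.symm
      · have := colourConn_line (S := S) (c := c) (y := w) haS hn fun k hk _ => by
          rcases hk.eq_or_lt with rfl | hk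
          · simpa using h1
          · exact hstd _ _ (.inl (h2 ⟨k, rfl, hk⟩))
        rwa [zero_zsmul, add_zero] at this
    exact ⟨this x (by simp), this (x + b) (by simp)⟩
  have cx : ∀ v, ColourConn S c a v x ↔ Touches S c a v α := fun v => by
    rw [hz α]
    have := (hz α x).1 hx.1
    exact ⟨fun h => h.trans this, fun h => h.trans this.symm⟩
  have cy : ∀ v, ColourConn S c a v (x + b) ↔ Touches S c a v β := fun v => by
    rw [hz β]
    have := (hz β (x + b)).1 hx.2
    exact ⟨fun h => h.trans this, fun h => h.trans this.symm⟩
  have hi := hM.matching.invol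
  have hn := hM.matching.ne
  have tx : ∀ γ, ColourConn S c a (z γ) x ↔ γ = α ∨ γ = M α := fun γ => by
    obtain ⟨p, hp⟩ := hM.exists_touches_iff x
    have h1 := (hp α).1 hx.1
    have : ColourConn S c a (z γ) x ↔ Touches S c a x γ := by
      rw [hz γ]; exact ⟨.symm, .symm⟩
    rw [this, hp]
    have := hi p; have := hi α
    grind
  have ty : ∀ γ, ColourConn S c a (z γ) (x + b) ↔ γ = β ∨ γ = M β := fun γ => by
    obtain ⟨p, hp⟩ := hM.exists_touches_iff (x + b)
    have h1 := (hp β).1 hx.2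
    have : ColourConn S c a (z γ) (x + b) ↔ Touches S c a (x + b) γ := by
      rw [hz γ]; exact ⟨.symm, .symm⟩
    rw [this, hp]
    have := hi p; have := hi β
    grind
  have hin : ∀ v ∈ U, ∀ γ, Touches S c' a v γ ↔ γ = α ∨ γ = β := fun v hv γ => by
    rw [hz', hconn, hzU]
    tauto
  have hout : ∀ v ∉ U, ∀ γ, Touches S c' a v γ ↔ ¬ (γ = α ∨ γ = β) ∧
      (Touches S c a v γ ∨ (Touches S c a v α ∧ γ = M β) ∨ (Touches S c a v β ∧ γ = M α)) :=
    fun v hv γ => by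
    rw [hz', hconn, hzU, ← hz, tx, ty, cx, cy]
    tauto
  have hrel : ∀ v ∉ U, ∀ p, (∀ γ, Touches S c a v γ ↔ γ = p ∨ γ = M p) → ∀ γ,
      Touches S c' a v γ ↔ γ = relabel M α β p ∨ γ = rematch M α β (relabel M α β p) := by
    intro v hv p hp γ
    rw [hout v hv, hp, hp, hp]
    have := hi p; have := hi α; have := hi β; have := hi γ
    have := hn p; have := hn α; have := hn β; have := hn γ
    unfold rematch relabel
    grind
  refine ⟨⟨hM.matching.rematch hαβ hne, fun v => ?_⟩, fun v hv γ h => ?_⟩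
  · by_cases hv : v ∈ U
    · refine ⟨α, fun γ => ?_⟩
      rw [hin v hv, rematch, if_pos rfl]
    · obtain ⟨p, hp⟩ := hM.exists_touches_iff v
      exact ⟨_, hrel v hv p hp⟩
  · obtain ⟨p, hp⟩ := hM.exists_touches_iff v
    have hγ : ∀ δ, Touches S c a v δ ↔ δ = γ ∨ δ = M γ := by
      intro δ
      have h1 := (hp γ).1 h
      rw [hp]
      have := hi p; have := hi γ
      grind
    exact (hrel v hv γ hγ _).2 (.inl rfl)

end Switching

/-! ### Valid colourings and moves -/

section Moves

variable {Γ : Type*} [AddCommGroup Γ]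

/-- The half-edges at `v` in direction `g` and, for the sign `false`, in direction `-g`. -/
def halfEdge (v : Γ) (h : Γ × Bool) : Γ × Γ := (bif h.2 then v else v - h.1, h.1)

/-- Lines in direction `a` are adjacent if they differ by an element of `S` outside of `⟨a⟩`. -/
def LineAdj (S : Finset Γ) (a : Γ) (X Y : Γ ⧸ AddSubgroup.zmultiples a) : Prop :=
  ∃ b ∈ S, b ∉ AddSubgroup.zmultiples a ∧ (Y = X + ↑b ∨ X = Y + ↑b)

theorem LineAdj.symm {S : Finset Γ} {a : Γ} (X Y : Γ ⧸ AddSubgroup.zmultiples a)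
    (h : LineAdj S a X Y) : LineAdj S a Y X := by
  obtain ⟨b, hb, hb', h⟩ := h
  exact ⟨b, hb, hb', h.symm⟩

theorem LineAdj.irrefl {S : Finset Γ} {a : Γ} (X : Γ ⧸ AddSubgroup.zmultiples a) :
    ¬ LineAdj S a X X := by
  rintro ⟨b, hb, hb', h⟩
  have : (b : Γ ⧸ AddSubgroup.zmultiples a) = 0 := by
    rcases h with h | h <;> exact left_eq_add.1 h
  exact hb' ((QuotientAddGroup.eq_zero_iff b).1 this)

/-- A matching of the ends of colour `a` which describes the components of colour `a`, and which
respects parities. -/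
structure IsEndMatching (S : Finset Γ) (c : Γ × Γ → Γ) (a : Γ) (M : LineEnd a → LineEnd a) :
    Prop where
  represents : Represents S c a M
  parity : ∀ γ, ParityLinked (LineAdj S a) true γ (M γ)

/-- A finite modification of the standard colouring each of whose colour classes is `2`-regular and
consists of double-rays. -/
structure ValidColouring (S : Finset Γ) (c : Γ × Γ → Γ) : Prop where
  finite : {e | c e ≠ e.2}.Finite
  mem : ∀ e : Γ × Γ, e.2 ∈ S → c e ∈ S
  regular : ∀ v, ∀ k ∈ S, {h : Γ × Bool | h.1 ∈ S ∧ c (halfEdge v h) = k}.ncard = 2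
  exists_matching : ∀ a ∈ S, ∃ M, IsEndMatching S c a M

theorem touches_congr {S : Finset Γ} {c c' : Γ × Γ → Γ} {a : Γ}
    (h : ∀ u v, ColourConn S c' a u v ↔ ColourConn S c a u v) (v : Γ) (γ : LineEnd a) :
    Touches S c' a v γ ↔ Touches S c a v γ := by
  simp only [Touches, h]

theorem IsEndMatching.congr {S : Finset Γ} {c c' : Γ × Γ → Γ} {a : Γ}
    (h : ∀ u v, ColourConn S c' a u v ↔ ColourConn S c a u v) {M : LineEnd a → LineEnd a}
    (hM : IsEndMatching S c a M) : IsEndMatching S c' a M :=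
  ⟨⟨hM.1.1, by simpa only [touches_congr h] using hM.1.2⟩, hM.2⟩

/-- At each corner of the square the switch interchanges one half-edge of colour a with one of
colour b; elsewhere nothing changes. Hence colour degrees are preserved. -/
theorem switchSquare_halfEdge {S : Finset Γ} {c : Γ × Γ → Γ} {x a b : Γ} (haS : a ∈ S)
    (hbS : b ∈ S) (ha : a ≠ 0) (hab : b ∉ AddSubgroup.zmultiples a)
    (hsq : IsStandardSquare c x a b) (v : Γ) :
    ∃ σ : Equiv.Perm (Γ × Bool), (∀ h, (σ h).1 ∈ S ↔ h.1 ∈ S) ∧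
      ∀ h, switchSquare c x a b (halfEdge v h) = c (halfEdge v (σ h)) := by
  classical
  have h1 : b ≠ 0 := by rintro rfl; exact hab (zero_mem _)
  have h2 : a ≠ b := by rintro rfl; exact hab (AddSubgroup.mem_zmultiples a)
  have h3 : a + b ≠ 0 := by
    intro h
    rw [add_comm] at h
    rw [eq_neg_of_add_eq_zero_left h] at hab
    exact hab (neg_mem (AddSubgroup.mem_zmultiples a))
  have hswap : ∀ (s t : Bool) (h : Γ × Bool), (Equiv.swap (a, s) (b, t) h).1 ∈ S ↔ h.1 ∈ S := by
    intro s t h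
    rw [Equiv.swap_apply_def]
    split_ifs with h1 h2 <;> simp [*]
  obtain ⟨e1, e2, e3, e4⟩ := hsq
  have e5 : x + a + b - a = x + b := by abel
  by_cases v1 : v = x
  · refine ⟨Equiv.swap (a, true) (b, true), hswap _ _, ?_⟩
    subst v1
    rintro ⟨g, t⟩
    cases t <;> by_cases hga : g = a <;> by_cases hgb : g = b <;>
      simp only [switchSquare, halfEdge, Equiv.swap_apply_def, Prod.mk.injEq, cond_true, cond_false,
        reduceCtorEq, and_false, if_false, and_true, if_true, hga, hgb, h2, h2.symm] <;> grind
  by_cases v2 : v = x + a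
  · refine ⟨Equiv.swap (a, false) (b, true), hswap _ _, ?_⟩
    subst v2
    rintro ⟨g, t⟩
    cases t <;> by_cases hga : g = a <;> by_cases hgb : g = b <;>
      simp only [switchSquare, halfEdge, Equiv.swap_apply_def, Prod.mk.injEq, cond_true, cond_false,
        reduceCtorEq, and_false, if_false, and_true, if_true, hga, hgb, h2, h2.symm,
        add_sub_cancel_right] <;> grind
  by_cases v3 : v = x + b
  · refine ⟨Equiv.swap (a, true) (b, false), hswap _ _, ?_⟩
    subst v3
    rintro ⟨g, t⟩
    cases t <;> by_cases hga : g = a <;> by_cases hgb : g = b <;>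
      simp only [switchSquare, halfEdge, Equiv.swap_apply_def, Prod.mk.injEq, cond_true, cond_false,
        reduceCtorEq, and_false, if_false, and_true, if_true, hga, hgb, h2, h2.symm,
        add_sub_cancel_right] <;> grind
  by_cases v4 : v = x + a + b
  · refine ⟨Equiv.swap (a, false) (b, false), hswap _ _, ?_⟩
    subst v4
    rintro ⟨g, t⟩
    cases t <;> by_cases hga : g = a <;> by_cases hgb : g = b <;>
      simp only [switchSquare, halfEdge, Equiv.swap_apply_def, Prod.mk.injEq, cond_true, cond_false,
        reduceCtorEq, and_false, if_false, and_true, if_true, hga, hgb, h2, h2.symm,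
        add_sub_cancel_right, e5] <;> grind
  · refine ⟨Equiv.refl _, fun _ => Iff.rfl, ?_⟩
    rintro ⟨g, t⟩
    cases t <;> simp only [switchSquare, halfEdge, Equiv.refl_apply, Prod.mk.injEq,
      cond_true, cond_false] <;> grind

theorem colourStep_switchSquare {S : Finset Γ} {c : Γ × Γ → Γ} {x a b : Γ}
    (hsq : IsStandardSquare c x a b) {k : Γ} (hka : k ≠ a) (hkb : k ≠ b) :
    ColourStep S (switchSquare c x a b) k = ColourStep S c k := by
  obtain ⟨e1, e2, e3, e4⟩ := hsq
  have : ∀ e, switchSquare c x a b e = k ↔ c e = k := by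
    intro e
    unfold switchSquare
    split_ifs with h1 h2
    · rcases h1 with rfl | rfl <;> simp [*, hka.symm, hkb.symm]
    · rcases h2 with rfl | rfl <;> simp [*, hka.symm, hkb.symm]
    · rfl
  funext u v
  simp only [ColourStep, this]

theorem ValidColouring.switchSquare {S : Finset Γ} {c : Γ × Γ → Γ} (hc : ValidColouring S c)
    {x a b : Γ} (haS : a ∈ S) (hbS : b ∈ S) (ha : a ≠ 0) (hab : b ∉ AddSubgroup.zmultiples a)
    (hsq : IsStandardSquare c x a b) (hA : ∃ M, IsEndMatching S (switchSquare c x a b) a M)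
    (hB : ∃ M, IsEndMatching S (_root_.switchSquare c x a b) b M) :
    ValidColouring S (_root_.switchSquare c x a b) where
  finite := finite_ne_switchSquare hc.finite x a b
  mem e he := by
    unfold _root_.switchSquare
    split_ifs
    exacts [hbS, haS, hc.mem e he]
  regular v k hk := by
    obtain ⟨σ, h1, h2⟩ := switchSquare_halfEdge haS hbS ha hab hsq v
    rw [← hc.regular v k hk, ← Set.ncard_image_of_injective _ σ.injective]
    congr 1
    ext h
    have := h1 (σ.symm h)
    rw [Equiv.apply_symm_apply] at this
    rw [Equiv.image_eq_preimage_symm]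
    simp [h2, this]
  exists_matching k hk := by
    by_cases hka : k = a
    · exact hka ▸ hA
    by_cases hkb : k = b
    · exact hkb ▸ hB
    obtain ⟨M, hM⟩ := hc.exists_matching k hk
    refine ⟨M, hM.congr fun u v => ?_⟩
    rw [ColourConn, ColourConn, colourStep_switchSquare hsq hka hkb]

theorem endAdj_lineAdj {S : Finset Γ} {a b : Γ} (hbS : b ∈ S)
    (hab : b ∉ AddSubgroup.zmultiples a) (x : Γ) (s : Bool) :
    EndAdj (LineAdj S a) ((x : Γ ⧸ AddSubgroup.zmultiples a), s) (↑(x + b), s) :=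
  ⟨⟨b, hbS, hab, .inl (QuotientAddGroup.mk_add _ _ _)⟩, rfl⟩

theorem IsEndMatching.switchSquare {S : Finset Γ} {c : Γ × Γ → Γ} {x a b : Γ} (haS : a ∈ S)
    (hbS : b ∈ S) (ha : ¬ IsOfFinAddOrder a) (hab : b ∉ AddSubgroup.zmultiples a)
    (hfin : {e | c e ≠ e.2}.Finite) (hsq : IsStandardSquare c x a b) {s : Bool}
    (hstd : ∀ u g, u ∈ lineTail x a s ∪ lineTail (x + b) a s ∨
      u + g ∈ lineTail x a s ∪ lineTail (x + b) a s → c (u, g) = g)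
    {M : LineEnd a → LineEnd a} (hM : IsEndMatching S c a M) (hne : M (↑x, s) ≠ (↑(x + b), s)) :
    IsEndMatching S (switchSquare c x a b) a (rematch M (↑x, s) (↑(x + b), s)) :=
  ⟨(hM.1.switchSquare haS hbS ha hab hfin hsq hstd hne).1,
    ParityLinked.rematch LineAdj.symm hM.2 (endAdj_lineAdj hbS hab x s)⟩

/-- The result of a move of colour `a`: a rematching of the ends `α` and `β`, where the edges in `F`
keep their colours, and the labels of the vertices in `U` follow the rule `relabel`. -/
structure IsMove (S : Finset Γ) (c c' : Γ × Γ → Γ) (F : Set (Γ × Γ)) (U : Set Γ) (a : Γ)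
    (M : LineEnd a → LineEnd a) (α β : LineEnd a) : Prop where
  valid : ValidColouring S c'
  eqOn : ∀ e ∈ F, c' e = c e
  matching : IsEndMatching S c' a (rematch M α β)
  touches : ∀ v ∈ U, ∀ γ, Touches S c a v γ → Touches S c' a v (relabel M α β γ)

theorem mk_add_zsmul (a y : Γ) (n : ℤ) :
    ((y + n • a : Γ) : Γ ⧸ AddSubgroup.zmultiples a) = y :=
  (mk_eq_iff_exists.2 ⟨n, rfl⟩).symm

/-- Everything needed in colour a, and avoidance of F and U, holds for all squares far out on side
s. Colour b therefore only has to behave well for infinitely many of them. The last clause lets a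
preliminary move leave a third colour untouched. -/
theorem exists_isMove_of_frequently {S : Finset Γ} {c : Γ × Γ → Γ} (hc : ValidColouring S c)
    {a b : Γ} (haS : a ∈ S) (hbS : b ∈ S) (ha : ¬ IsOfFinAddOrder a)
    (hab : b ∉ AddSubgroup.zmultiples a) {M : LineEnd a → LineEnd a} (hM : IsEndMatching S c a M)
    {y : Γ} {s : Bool} (hne : M (↑y, s) ≠ (↑(y + b), s)) {F : Set (Γ × Γ)} (hF : F.Finite)
    {U : Set Γ} (hU : U.Finite)
    (hB : ∃ᶠ n in sideFilter s, IsStandardSquare c (y + n • a) a b →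
      ∃ M', IsEndMatching S (switchSquare c (y + n • a) a b) b M') :
    ∃ c', IsMove S c c' F U a M (↑y, s) (↑(y + b), s) ∧
      ∀ k, k ≠ a → k ≠ b → ColourStep S c' k = ColourStep S c k := by
  have hD : (edgeEnds ({e | c e ≠ e.2} ∪ F) ∪ U).Finite := (hc.finite.union hF).edgeEnds.union hU
  have hev : ∀ᶠ n in sideFilter s, ∀ m, Beyond s n m →
      y + m • a ∉ edgeEnds ({e | c e ≠ e.2} ∪ F) ∪ U ∧
      y + b + m • a ∉ edgeEnds ({e | c e ≠ e.2} ∪ F) ∪ U := by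
    filter_upwards [eventually_beyond_notMem ha hD y s, eventually_beyond_notMem ha hD (y + b) s]
      with n h1 h2 m hm
    exact ⟨h1 m hm, h2 m hm⟩
  -- The shift by 1 controls the corner x + a, which for s = `false` lies one step nearer than x.
  obtain ⟨n, hBn, h1, h2⟩ :=
    (hB.and_eventually (hev.and ((eventually_sideFilter_add 1).2 hev))).exists
  rw [add_comm 1 n] at h2
  have hx0 := h1 n (.refl s n)
  have hx1 := h2 (n + 1) (.refl s (n + 1))
  have ex : (((y + n • a : Γ) : Γ ⧸ AddSubgroup.zmultiples a)) = y := mk_add_zsmul a y n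
  have ex' : (((y + n • a + b : Γ) : Γ ⧸ AddSubgroup.zmultiples a)) = ↑(y + b) := by
    rw [add_right_comm]; exact mk_add_zsmul a _ n
  rw [add_zsmul, one_zsmul, ← add_assoc, ← add_assoc, add_right_comm y b] at hx1
  rw [add_right_comm y b] at hx0
  have htail : ∀ u ∈ lineTail (y + n • a) a s ∪ lineTail (y + n • a + b) a s,
      u ∉ edgeEnds ({e | c e ≠ e.2} ∪ F) ∪ U := by
    have hb : ∀ m : ℤ, (bif s then 1 ≤ m else m ≤ 0) → Beyond s n (n + m) := by
      intro m hm
      cases s <;> simp only [Beyond, cond_true, cond_false] at * <;> omega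
    rintro u (⟨m, rfl, hm⟩ | ⟨m, rfl, hm⟩)
    · have := (h1 _ (hb m hm)).1
      rwa [add_zsmul, ← add_assoc] at this
    · have := (h1 _ (hb m hm)).2
      rwa [add_zsmul, ← add_assoc, add_right_comm y b] at this
  have fst : ∀ u g, u ∉ edgeEnds ({e | c e ≠ e.2} ∪ F) ∪ U → c (u, g) = g ∧ (u, g) ∉ F := by
    intro u g hu
    have := notMem_of_fst_notMem_edgeEnds (g := g) fun h => hu (.inl h)
    simpa using this
  have snd : ∀ u g, u + g ∉ edgeEnds ({e | c e ≠ e.2} ∪ F) ∪ U → c (u, g) = g ∧ (u, g) ∉ F := by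
    intro u g hu
    have := notMem_of_snd_notMem_edgeEnds fun h => hu (.inl h)
    simpa using this
  have hsq : IsStandardSquare c (y + n • a) a b :=
    ⟨(fst _ _ hx0.1).1, (fst _ _ hx0.2).1, (fst _ _ hx0.1).1, (fst _ _ hx1.1).1⟩
  have hstd : ∀ u g, u ∈ lineTail (y + n • a) a s ∪ lineTail (y + n • a + b) a s ∨
      u + g ∈ lineTail (y + n • a) a s ∪ lineTail (y + n • a + b) a s → c (u, g) = g := by
    rintro u g (h | h)
    · exact (fst _ _ (htail _ h)).1
    · exact (snd _ _ (htail _ h)).1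
  have hne' : M (↑(y + n • a), s) ≠ (↑(y + n • a + b), s) := by rwa [ex, ex']
  have ha0 : a ≠ 0 := by rintro rfl; exact ha .zero
  have hA := hM.switchSquare haS hbS ha hab hc.finite hsq hstd hne'
  have hA' := hM.1.switchSquare haS hbS ha hab hc.finite hsq hstd hne'
  refine ⟨switchSquare c (y + n • a) a b, ⟨hc.switchSquare haS hbS ha0 hab hsq ⟨_, hA⟩ (hBn hsq),
    fun e he => ?_, ?_, fun v hv γ h => ?_⟩, fun k => colourStep_switchSquare hsq⟩
  · have hne : ∀ u g, (u, g) ∉ F → e ≠ (u, g) := fun u g h h' => h (h' ▸ he)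
    unfold switchSquare
    rw [if_neg, if_neg]
    · exact not_or.2 ⟨hne _ _ (fst _ _ hx0.1).2, hne _ _ (fst _ _ hx1.1).2⟩
    · exact not_or.2 ⟨hne _ _ (fst _ _ hx0.1).2, hne _ _ (fst _ _ hx0.2).2⟩
  · rwa [ex, ex'] at hA
  · have := hA'.2 v (fun h => htail v h (.inr hv)) γ h
    rwa [ex, ex'] at this

/-- The elements `a` and `b` generate a free abelian group of rank two. -/
def Independent (a b : Γ) : Prop := ∀ m n : ℤ, m • a + n • b = 0 → m = 0 ∧ n = 0

/-- If `x` moves far away in direction `a`, then one of the halves of its line in direction `b`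
avoids a finite set. -/
theorem exists_eventually_halfLine_notMem {a b : Γ} (ha : ¬ IsOfFinAddOrder a)
    (hb : ¬ IsOfFinAddOrder b) (s : Bool) :
    ∃ t, ∀ y : Γ, ∀ B : Set Γ, B.Finite → ∀ᶠ n in sideFilter s, ∀ m, Beyond t 0 m →
      y + n • a + m • b ∉ B := by
  have main : ∃ t, ∀ n₀ m₀ : ℤ, ∀ᶠ n in sideFilter s, ∀ m : ℤ, Beyond t 0 m →
      n • a + m • b ≠ n₀ • a + m₀ • b := by
    by_cases hdep : ∃ i j : ℤ, 0 < i ∧ i • a = j • b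
    · obtain ⟨i, j, hi, hij⟩ := hdep
      have hj : j ≠ 0 := by
        rintro rfl
        rw [zero_zsmul] at hij
        exact hi.ne' (zsmul_eq_zero_of_infinite ha hij)
      -- If i • a = j • b with i > 0, moving towards s along a means moving along b to the side
      -- given by the sign of j. The half-line continuing that way escapes every point, at the
      -- latest once |n - n₀| exceeds i * |m₀|.
      refine ⟨s ^^ decide (j < 0), fun n₀ m₀ => ?_⟩
      filter_upwards [eventually_beyond s (n₀ + (bif s then 1 else -1) * (i * |m₀| + 1))]
        with n hn m hm h
      have key : (n - n₀) * j = i * (m₀ - m) := by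
        apply zsmul_inj_of_infinite hb
        have h' : (n - n₀) • a = (m₀ - m) • b := by
          rw [sub_smul, sub_smul, sub_eq_sub_iff_add_eq_add, h, add_comm]
        rw [mul_zsmul, ← hij, mul_zsmul, ← h', ← mul_zsmul, ← mul_zsmul, mul_comm]
      have k1 := le_abs_self m₀
      have k2 := neg_abs_le m₀
      have p1 := mul_le_mul_of_nonneg_left k1 hi.le
      have p2 := mul_le_mul_of_nonneg_left k2 hi.le
      have p3 := mul_nonneg hi.le (abs_nonneg m₀)
      rcases lt_or_gt_of_ne hj with hj | hj <;> cases s <;>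
        simp only [hj, hj.not_gt, decide_true, decide_false, Bool.xor_true, Bool.xor_false,
          Bool.not_true, Bool.not_false, Beyond, cond_true, cond_false] at hn hm
      · have := mul_nonneg hi.le hm
        nlinarith [mul_nonneg (show 0 ≤ -j - 1 by omega) (show 0 ≤ n₀ - n by omega)]
      · have := mul_nonneg hi.le (neg_nonneg.2 hm)
        nlinarith [mul_nonneg (show 0 ≤ -j - 1 by omega) (show 0 ≤ n - n₀ by omega)]
      · have := mul_nonneg hi.le (neg_nonneg.2 hm)
        nlinarith [mul_nonneg (show 0 ≤ j - 1 by omega) (show 0 ≤ n₀ - n by omega)]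
      · have := mul_nonneg hi.le hm
        nlinarith [mul_nonneg (show 0 ≤ j - 1 by omega) (show 0 ≤ n - n₀ by omega)]
    · refine ⟨true, fun n₀ m₀ => ?_⟩
      -- Here different n give different b-lines, so a given point is met for at most one n.
      filter_upwards [eventually_ne_sideFilter s n₀] with n hn m _ h
      have h' : (n - n₀) • a = (m₀ - m) • b := by
        rw [sub_smul, sub_smul, sub_eq_sub_iff_add_eq_add, h, add_comm]
      rcases lt_or_gt_of_ne hn with hn | hn
      · refine hdep ⟨n₀ - n, m - m₀, by omega, ?_⟩
        rw [← neg_sub n, ← neg_sub m₀, neg_zsmul, neg_zsmul, h']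
      · exact hdep ⟨n - n₀, m₀ - m, by omega, h'⟩
  obtain ⟨t, ht⟩ := main
  refine ⟨t, fun y B hB => ?_⟩
  have : ∀ᶠ n in sideFilter s, ∀ z ∈ B, ∀ m, Beyond t 0 m → y + n • a + m • b ≠ z := by
    rw [Filter.eventually_all_finite hB]
    intro z _
    by_cases h : ∃ n₀ m₀ : ℤ, y + (n₀ • a + m₀ • b) = z
    · obtain ⟨n₀, m₀, rfl⟩ := h
      filter_upwards [ht n₀ m₀] with n hn m hm h
      rw [add_assoc] at h
      exact hn m hm (add_left_cancel h)
    · push Not at h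
      refine .of_forall fun n m _ => ?_
      rw [add_assoc]
      exact h n m
  filter_upwards [this] with n hn m hm hmB
  exact hn _ hmB m hm rfl

/-- Switching a square does not change the components of colour `b` if its two edges of this colour
lie on the same line. -/
theorem eventually_isEndMatching_of_mem {S : Finset Γ} {c : Γ × Γ → Γ} (hc : ValidColouring S c)
    {a b : Γ} (haS : a ∈ S) (hbS : b ∈ S) (ha : ¬ IsOfFinAddOrder a) (hb : ¬ IsOfFinAddOrder b)
    (hab : b ∉ AddSubgroup.zmultiples a) (hba : a ∈ AddSubgroup.zmultiples b) (y : Γ) (s : Bool) :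
    ∀ᶠ n in sideFilter s, IsStandardSquare c (y + n • a) a b →
      ∃ M', IsEndMatching S (switchSquare c (y + n • a) a b) b M' := by
  obtain ⟨k, rfl⟩ := AddSubgroup.mem_zmultiples_iff.1 hba
  have hne : k • b ≠ b := by
    intro h
    rw [h] at hab
    exact hab (AddSubgroup.mem_zmultiples b)
  -- With a = k • b, both b-edges of the square lie on one b-line. Far out, the segment between them
  -- is unmodified.
  have hev : ∀ᶠ n in sideFilter s, ∀ i ∈ Set.Icc (-|k|) |k|, c (y + n • k • b + i • b, b) = b := by
    rw [Filter.eventually_all_finite (Set.finite_Icc _ _)]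
    intro i _
    filter_upwards [eventually_beyond_notMem ha hc.finite.edgeEnds (y + i • b) s] with n hn
    have := notMem_of_fst_notMem_edgeEnds (g := b) (hn n (.refl s n))
    rw [add_right_comm] at this
    simpa using this
  filter_upwards [hev] with n hn hsq
  generalize y + n • k • b = x at *
  obtain ⟨M, hM⟩ := hc.exists_matching b hbS
  refine ⟨M, hM.congr fun u v => ?_⟩
  have e := Relation.EqvGen.is_equivalence (ColourStep S c b)
  have e' := Relation.EqvGen.is_equivalence (ColourStep S (switchSquare c x (k • b) b) b)
  have c1 : ColourConn S c b x (x + b) := .of_edge hbS hsq.right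
  have c2 : ColourConn S c b (x + k • b) (x + k • b + b) := .of_edge hbS hsq.right'
  have c3 : ColourConn S c b x (x + k • b) := by
    rcases le_total 0 k with hk | hk
    · have := colourConn_line (S := S) (c := c) (y := x) hbS hk fun i hi hi' =>
        hn i ⟨by have := neg_nonpos.2 (abs_nonneg k); omega, hi'.le.trans (le_abs_self k)⟩
      simpa using this
    · have := colourConn_line (S := S) (c := c) (y := x) hbS hk fun i hi hi' =>
        hn i ⟨(neg_abs_le k).trans hi, hi'.le.trans (abs_nonneg k)⟩
      simpa using this.symm
  have d1 : ColourConn S (switchSquare c x (k • b) b) b x (x + k • b) :=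
    .of_edge haS (by simp [switchSquare])
  have d2 : ColourConn S (switchSquare c x (k • b) b) b (x + b) (x + k • b + b) := by
    rw [add_right_comm]
    exact .of_edge haS (by simp [switchSquare])
  have hk0 : k ≠ 0 := by
    rintro rfl
    rw [zero_zsmul] at ha
    exact ha .zero
  have hsame : ∀ i ∈ Set.Icc (-|k|) |k|, i ≠ 0 → i ≠ k →
      switchSquare c x (k • b) b (x + i • b, b) = b := by
    intro i hi hi0 hik
    unfold switchSquare
    rw [if_neg, if_neg, hn i hi]
    · rintro (h | h) <;> rw [Prod.mk.injEq] at h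
      · exact hi0 (zsmul_eq_zero_of_infinite hb (by simpa using h.1))
      · exact hik (zsmul_inj_of_infinite hb (add_left_cancel h.1))
    · rintro (h | h) <;> exact hne (Prod.ext_iff.1 h).2.symm
  -- The new path jumps over the segment, runs back through it and jumps again, so the segment is
  -- merely reversed and the component keeps its vertices.
  have d3 : ColourConn S (switchSquare c x (k • b) b) b x (x + b) ∧
      ColourConn S (switchSquare c x (k • b) b) b (x + k • b) (x + k • b + b) := by
    rcases lt_or_gt_of_ne hk0 with hk | hk
    · have := colourConn_line (S := S) (c := switchSquare c x (k • b) b) (y := x) (m := k + 1)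
        (n := 0) hbS (by omega) fun i hi hi' =>
        hsame i ⟨by have := neg_abs_le k; omega, hi'.le.trans (abs_nonneg k)⟩ hi'.ne (by omega)
      rw [zero_zsmul, add_zero, add_zsmul, one_zsmul, ← add_assoc] at this
      exact ⟨this.symm.trans d2.symm, d1.symm.trans this.symm⟩
    · have := colourConn_line (S := S) (c := switchSquare c x (k • b) b) (y := x) (m := 1)
        (n := k) hbS (by omega) fun i hi hi' =>
        hsame i ⟨by have := abs_nonneg k; omega, hi'.le.trans (le_abs_self k)⟩ (by omega) hi'.ne
      rw [one_zsmul] at this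
      exact ⟨d1.trans this.symm, this.symm.trans d2⟩
  constructor
  · intro h
    induction h with
    | rel u v h =>
      obtain ⟨g, hg, h, rfl⟩ := h
      by_cases h1 : (u, g) = (x, k • b)
      · rw [Prod.mk.injEq] at h1
        rw [h1.1, h1.2]; exact c3
      by_cases h2 : (u, g) = (x + b, k • b)
      · rw [Prod.mk.injEq] at h2
        rw [h2.1, h2.2, add_right_comm]
        exact c1.symm.trans (c3.trans c2)
      unfold switchSquare at h
      rw [if_neg (by tauto)] at h
      split_ifs at h with h3
      · exact absurd h hne
      · exact .of_edge hg h
    | refl u => exact e.refl u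
    | symm u v _ ih => exact e.symm ih
    | trans u v w _ _ ih ih' => exact e.trans ih ih'
  · intro h
    induction h with
    | rel u v h =>
      obtain ⟨g, hg, h, rfl⟩ := h
      by_cases h1 : (u, g) = (x, b)
      · rw [Prod.mk.injEq] at h1
        rw [h1.1, h1.2]; exact d3.1
      by_cases h2 : (u, g) = (x + k • b, b)
      · rw [Prod.mk.injEq] at h2
        rw [h2.1, h2.2]; exact d3.2
      refine .of_edge hg ?_
      unfold switchSquare
      split_ifs with h3 h4
      · rfl
      · tauto
      · exact h
    | refl u => exact e'.refl u
    | symm u v _ ih => exact e'.symm ih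
    | trans u v w _ _ ih ih' => exact e'.trans ih ih'

/-- Switching a square whose edges of colour `b` lie on different lines. -/
theorem frequently_isEndMatching {S : Finset Γ} {c : Γ × Γ → Γ} (hc : ValidColouring S c)
    {a b : Γ} (haS : a ∈ S) (hbS : b ∈ S) (hb : ¬ IsOfFinAddOrder b)
    (hba : a ∉ AddSubgroup.zmultiples b) {y : Γ} {s t : Bool}
    (ht : ∀ y : Γ, ∀ B : Set Γ, B.Finite → ∀ᶠ n in sideFilter s, ∀ m, Beyond t 0 m →
      y + n • a + m • b ∉ B) {M : LineEnd b → LineEnd b} (hM : IsEndMatching S c b M)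
    (hne : ∃ᶠ n in sideFilter s, M (↑(y + n • a), t) ≠ (↑(y + n • a + a), t)) :
    ∃ᶠ n in sideFilter s, IsStandardSquare c (y + n • a) a b →
      ∃ M', IsEndMatching S (switchSquare c (y + n • a) a b) b M' := by
  refine (hne.and_eventually ((ht y _ hc.finite.edgeEnds).and
    (ht (y + a) _ hc.finite.edgeEnds))).mono ?_
  rintro n ⟨hne, h1, h2⟩ hsq
  rw [add_right_comm] at h2
  generalize y + n • a = x at *
  have hab : a ≠ b := by rintro rfl; exact hba (AddSubgroup.mem_zmultiples a)
  have htail : ∀ u ∈ lineTail x b t ∪ lineTail (x + a) b t,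
      u ∉ edgeEnds {e : Γ × Γ | c e ≠ e.2} := by
    have hbey : ∀ m : ℤ, (bif t then 1 ≤ m else m ≤ 0) → Beyond t 0 m := by
      intro m hm
      cases t <;> simp only [Beyond, cond_true, cond_false] at * <;> omega
    rintro u (⟨m, rfl, hm⟩ | ⟨m, rfl, hm⟩)
    · exact h1 _ (hbey m hm)
    · exact h2 _ (hbey m hm)
  rw [switchSquare_comm c x hab]
  refine ⟨_, hM.switchSquare hbS haS hb hba hc.finite hsq.symm (s := t) ?_ hne⟩
  rintro u g (h | h)
  · simpa using notMem_of_fst_notMem_edgeEnds (g := g) (htail _ h)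
  · simpa using notMem_of_snd_notMem_edgeEnds (htail _ h)

/-- Were M to match the ends of both consecutive pairs x, x + a and x + a, x + 2a, involutivity
would make the b-lines of x and x + 2a equal. -/
theorem frequently_ne_of_two_nsmul_notMem {a b : Γ} (h2a : a + a ∉ AddSubgroup.zmultiples b)
    {M : LineEnd b → LineEnd b} (hM : IsMatchingMap M) (y : Γ) (s t : Bool) :
    ∃ᶠ n in sideFilter s, M (↑(y + n • a), t) ≠ (↑(y + n • a + a), t) := by
  rw [Filter.Frequently]
  simp only [ne_eq, not_not]
  intro h
  obtain ⟨n, h1, h2⟩ := (h.and ((eventually_sideFilter_add 1).2 h)).exists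
  rw [add_comm 1 n, add_zsmul, one_zsmul, ← add_assoc, ← h1, hM.invol] at h2
  have h3 : ((y + n • a : Γ) : Γ ⧸ AddSubgroup.zmultiples b) = ↑(y + n • a + a + a) :=
    (Prod.ext_iff.1 h2).1
  obtain ⟨k, hk⟩ := mk_eq_iff_exists.1 h3
  rw [add_assoc] at hk
  exact h2a (AddSubgroup.mem_zmultiples_iff.2 ⟨k, (add_left_cancel hk).symm⟩)

end Moves

/-! ### Existence of moves and the limit colouring -/

section Existence

variable {Γ : Type*} [AddCommGroup Γ]

theorem Independent.right_notMem {a b : Γ} (h : Independent a b) :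
    b ∉ AddSubgroup.zmultiples a := by
  intro hb
  obtain ⟨k, rfl⟩ := AddSubgroup.mem_zmultiples_iff.1 hb
  have := h (-k) 1 (by rw [neg_zsmul, one_zsmul, neg_add_cancel])
  omega

theorem Independent.left_notMem {a b : Γ} (h : Independent a b) :
    a ∉ AddSubgroup.zmultiples b := by
  intro hb
  obtain ⟨k, rfl⟩ := AddSubgroup.mem_zmultiples_iff.1 hb
  have := h 1 (-k) (by rw [neg_zsmul, one_zsmul, add_neg_cancel])
  omega

theorem Independent.left_add_left_notMem {a b : Γ} (h : Independent a b) :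
    a + a ∉ AddSubgroup.zmultiples b := by
  intro hb
  obtain ⟨k, hk⟩ := AddSubgroup.mem_zmultiples_iff.1 hb
  have := h 2 (-k) (by rw [neg_zsmul, two_zsmul, hk, add_neg_cancel])
  omega

theorem exists_isMove_of_two_nsmul_notMem {S : Finset Γ} (hinf : ∀ g ∈ S, ¬ IsOfFinAddOrder g)
    {c : Γ × Γ → Γ} (hc : ValidColouring S c)
    {a b : Γ} (haS : a ∈ S) (hbS : b ∈ S) (hab : b ∉ AddSubgroup.zmultiples a)
    (hba : a ∉ AddSubgroup.zmultiples b) (h2a : a + a ∉ AddSubgroup.zmultiples b)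
    {M : LineEnd a → LineEnd a} (hM : IsEndMatching S c a M)
    {y : Γ} {s : Bool} (hne : M (↑y, s) ≠ (↑(y + b), s)) {F : Set (Γ × Γ)} (hF : F.Finite)
    {U : Set Γ} (hU : U.Finite) :
    ∃ c', IsMove S c c' F U a M (↑y, s) (↑(y + b), s) ∧
      ∀ k, k ≠ a → k ≠ b → ColourStep S c' k = ColourStep S c k := by
  obtain ⟨t, ht⟩ := exists_eventually_halfLine_notMem (hinf a haS) (hinf b hbS) s
  obtain ⟨N, hN⟩ := hc.exists_matching b hbS
  exact exists_isMove_of_frequently hc haS hbS (hinf a haS) hab hM hne hF hU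
    (frequently_isEndMatching hc haS hbS (hinf b hbS) hba ht hN
      (frequently_ne_of_two_nsmul_notMem h2a hN.1.1 y s t))

/-- The obstacle lies in colour b. It vanishes if a ∈ ⟨b⟩ or 2a ∉ ⟨b⟩. Otherwise the squares use
only two b-lines, whose relevant ends may be partners in N. Then a preliminary move in colours b and
k, with k independent of b, separates them without affecting colour a. -/
theorem exists_isMove {S : Finset Γ} (hinf : ∀ g ∈ S, ¬ IsOfFinAddOrder g)
    (hind : ∀ a ∈ S, ∃ b ∈ S, Independent a b) {c : Γ × Γ → Γ} (hc : ValidColouring S c)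
    {a b : Γ} (haS : a ∈ S) (hbS : b ∈ S) (hab : b ∉ AddSubgroup.zmultiples a)
    {M : LineEnd a → LineEnd a} (hM : IsEndMatching S c a M)
    {y : Γ} {s : Bool} (hne : M (↑y, s) ≠ (↑(y + b), s)) {F : Set (Γ × Γ)} (hF : F.Finite)
    {U : Set Γ} (hU : U.Finite) :
    ∃ c', IsMove S c c' F U a M (↑y, s) (↑(y + b), s) := by
  have ha := hinf a haS
  have hb := hinf b hbS
  by_cases hba : a ∈ AddSubgroup.zmultiples b
  · obtain ⟨c', h, -⟩ := exists_isMove_of_frequently hc haS hbS ha hab hM hne hF hU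
      (eventually_isEndMatching_of_mem hc haS hbS ha hb hab hba y s).frequently
    exact ⟨c', h⟩
  by_cases h2a : a + a ∈ AddSubgroup.zmultiples b
  swap
  · obtain ⟨c', h, -⟩ := exists_isMove_of_two_nsmul_notMem hinf hc haS hbS hab hba h2a hM hne hF hU
    exact ⟨c', h⟩
  obtain ⟨t, ht⟩ := exists_eventually_halfLine_notMem ha hb s
  obtain ⟨N, hN⟩ := hc.exists_matching b hbS
  by_cases hfr : ∃ᶠ n in sideFilter s, N (↑(y + n • a), t) ≠ (↑(y + n • a + a), t)
  · obtain ⟨c', h, -⟩ := exists_isMove_of_frequently hc haS hbS ha hab hM hne hF hU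
      (frequently_isEndMatching hc haS hbS hb hba ht hN hfr)
    exact ⟨c', h⟩
  rw [Filter.not_frequently] at hfr
  simp only [ne_eq, not_not] at hfr
  obtain ⟨n, hn⟩ := hfr.exists
  obtain ⟨k, hkS, hbk⟩ := hind b hbS
  set x := y + n • a with hx
  -- Otherwise k - a ∈ ⟨b⟩, and 2a ∈ ⟨b⟩ would give 2k ∈ ⟨b⟩.
  have hxk : ((x + a : Γ) : Γ ⧸ AddSubgroup.zmultiples b) ≠ ↑(x + k) := by
    intro h
    obtain ⟨i, hi⟩ := mk_eq_iff_exists.1 h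
    obtain ⟨j, hj⟩ := AddSubgroup.mem_zmultiples_iff.1 h2a
    rw [add_assoc x a] at hi
    have h3 := add_left_cancel hi
    have := hbk (-(j + 2 * i)) 2 (by
      rw [h3, zsmul_add, two_zsmul a, ← hj, neg_zsmul, ← mul_zsmul, ← add_zsmul, neg_add_cancel])
    omega
  have hka : a ≠ k := by
    rintro rfl
    obtain ⟨j, hj⟩ := AddSubgroup.mem_zmultiples_iff.1 h2a
    have := hbk (-j) 2 (by rw [two_zsmul, ← hj, neg_zsmul, neg_add_cancel])
    omega
  have hab' : a ≠ b := by rintro rfl; exact hba (AddSubgroup.mem_zmultiples a)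
  have hne₁ : N (↑x, t) ≠ (↑(x + k), t) := by
    rw [hn]
    exact fun h => hxk (Prod.ext_iff.1 h).1
  obtain ⟨c₁, hc₁, hstep⟩ := exists_isMove_of_two_nsmul_notMem hinf hc hbS hkS hbk.right_notMem
    hbk.left_notMem hbk.left_add_left_notMem hN hne₁ hF Set.finite_empty
  have hconn : ∀ u v, ColourConn S c₁ a u v ↔ ColourConn S c a u v := by
    intro u v
    rw [ColourConn, hstep a hab' hka, ColourConn]
  have hfr₁ : ∃ᶠ m in sideFilter s,
      rematch N (↑x, t) (↑(x + k), t) (↑(y + m • a), t) ≠ (↑(y + m • a + a), t) := by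
    rw [Filter.Frequently]
    simp only [ne_eq, not_not]
    intro h
    obtain ⟨m, h1, h2⟩ := (h.and ((eventually_sideFilter_add 1).2 h)).exists
    have key : ∀ m : ℤ, ((y + m • a : Γ) : Γ ⧸ AddSubgroup.zmultiples b) = x →
        rematch N (↑x, t) (↑(x + k), t) (↑(y + m • a), t) ≠ (↑(y + m • a + a), t) := by
      intro m hm h
      rw [hm, rematch, if_pos rfl, QuotientAddGroup.mk_add _ (y + m • a), hm,
        ← QuotientAddGroup.mk_add] at h
      exact hxk (Prod.ext_iff.1 h).1.symm
    obtain ⟨j, hj⟩ := AddSubgroup.mem_zmultiples_iff.1 h2a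
    -- Since 2a ∈ ⟨b⟩, the b-line of y + m • a depends only on the parity of m, so one of m, m + 1
    -- yields the line of x.
    rcases Int.even_or_odd' (n - m) with ⟨i, hi | hi⟩
    · refine key m (mk_eq_iff_exists.2 ⟨i * j, ?_⟩) h1
      rw [mul_zsmul, hj, ← two_zsmul, ← mul_zsmul, hx, add_assoc, ← add_zsmul]
      congr 2; omega
    · refine key (1 + m) (mk_eq_iff_exists.2 ⟨i * j, ?_⟩) h2
      rw [mul_zsmul, hj, ← two_zsmul, ← mul_zsmul, hx, add_assoc, ← add_zsmul]
      congr 2; omega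
  obtain ⟨c', h, -⟩ := exists_isMove_of_frequently hc₁.valid haS hbS ha hab (hM.congr hconn) hne hF
    hU (frequently_isEndMatching hc₁.valid haS hbS hb hba ht hc₁.matching hfr₁)
  refine ⟨c', h.valid, fun e he => (h.eqOn e he).trans (hc₁.eqOn e he), h.matching, ?_⟩
  exact fun v hv γ hγ => h.touches v hv γ ((touches_congr hconn v γ).2 hγ)

/-- Each abstract rematching is realised by a move that spares F and keeps v and w out of the tails.
In the end both components contain a common end, hence coincide. -/
theorem exists_valid_colourConn_of_joinable {S : Finset Γ} (hinf : ∀ g ∈ S, ¬ IsOfFinAddOrder g)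
    (hind : ∀ a ∈ S, ∃ b ∈ S, Independent a b) {a : Γ} (haS : a ∈ S) {F : Set (Γ × Γ)}
    (hF : F.Finite) (v w : Γ) {M : LineEnd a → LineEnd a} {p q : LineEnd a}
    (h : Joinable (EndAdj (LineAdj S a)) M p q) :
    ∀ c, ValidColouring S c → IsEndMatching S c a M → Touches S c a v p → Touches S c a w q →
      ∃ c', ValidColouring S c' ∧ (∀ e ∈ F, c' e = c e) ∧ ColourConn S c' a v w := by
  have hflip : ∀ {M : LineEnd a → LineEnd a} {c}, IsEndMatching S c a M → ∀ u γ,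
      Touches S c a u γ → Touches S c a u (M γ) := by
    intro M c hM u γ h
    obtain ⟨p, hp⟩ := hM.1.2 u
    rw [hp] at h ⊢
    rcases h with rfl | rfl
    · exact .inr rfl
    · exact .inl (hM.1.1.invol p)
  induction h with
  | refl M p =>
    intro c hc hM hv hw
    obtain ⟨n, h1, h2⟩ := (hv.and hw).exists
    exact ⟨c, hc, fun _ _ => rfl, h1.trans h2.symm⟩
  | flip_left _ ih => exact fun c hc hM hv hw => ih c hc hM (hflip hM _ _ hv) hw
  | flip_right _ ih => exact fun c hc hM hv hw => ih c hc hM hv (hflip hM _ _ hw)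
  | @step M p q α β hA hne _ ih =>
    intro c hc hM hv hw
    have key : ∃ c', IsMove S c c' F {v, w} a M α β := by
      obtain ⟨X, s⟩ := α
      obtain ⟨Y, t⟩ := β
      obtain ⟨⟨b, hbS, hab, (rfl : Y = X + ↑b) | (rfl : X = Y + ↑b)⟩, rfl : s = t⟩ := hA
      · induction X using QuotientAddGroup.induction_on with
        | H x =>
        exact exists_isMove hinf hind hc haS hbS hab hM hne hF (Set.toFinite _)
      · induction Y using QuotientAddGroup.induction_on with
        | H y =>
        have hne' : M (↑y, s) ≠ (↑(y + b), s) := by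
          intro h
          apply hne
          have := hM.1.1.invol (↑y, s)
          rwa [h] at this
        have hne₂ : ((y : Γ ⧸ AddSubgroup.zmultiples a) + (b : Γ ⧸ AddSubgroup.zmultiples a), s) ≠
            (↑y, s) := by
          intro h
          have := add_eq_left.1 (Prod.ext_iff.1 h).1
          exact hab ((QuotientAddGroup.eq_zero_iff b).1 this)
        obtain ⟨c', hc'⟩ := exists_isMove hinf hind hc haS hbS hab hM hne' hF
          (Set.toFinite {v, w})
        refine ⟨c', hc'.valid, hc'.eqOn, ?_, ?_⟩
        · rw [rematch_comm hM.1.1 hne₂]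
          exact hc'.matching
        · rw [relabel_comm]
          exact hc'.touches
    obtain ⟨c₁, h₁⟩ := key
    obtain ⟨c', h1, h2, h3⟩ := ih c₁ h₁.valid h₁.matching (h₁.touches v (by simp) _ hv)
      (h₁.touches w (by simp) _ hw)
    exact ⟨c', h1, fun e he => (h2 e he).trans (h₁.eqOn e he), h3⟩

theorem exists_walk_lineAdj {S : Finset Γ} (hS : AddSubgroup.closure (S : Set Γ) = ⊤) (a : Γ)
    (X Y : Γ ⧸ AddSubgroup.zmultiples a) : ∃ n, WalkOfLength (LineAdj S a) n X Y := by
  have key : ∀ g : Γ, ∀ X : Γ ⧸ AddSubgroup.zmultiples a,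
      ∃ n, WalkOfLength (LineAdj S a) n X (X + ↑g) := by
    intro g
    have hg : g ∈ AddSubgroup.closure (S : Set Γ) := hS ▸ AddSubgroup.mem_top g
    induction hg using AddSubgroup.closure_induction with
    | mem b hb =>
      intro X
      by_cases h : b ∈ AddSubgroup.zmultiples a
      · rw [(QuotientAddGroup.eq_zero_iff b).2 h, add_zero]
        exact ⟨0, fun _ => X, rfl, rfl, by simp⟩
      · exact ⟨1, .single ⟨b, hb, h, .inl rfl⟩⟩
    | zero =>
      intro X
      rw [QuotientAddGroup.mk_zero, add_zero]
      exact ⟨0, fun _ => X, rfl, rfl, by simp⟩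
    | add g g' _ _ ih ih' =>
      intro X
      obtain ⟨n, hn⟩ := ih X
      obtain ⟨m, hm⟩ := ih' (X + ↑g)
      rw [QuotientAddGroup.mk_add, ← add_assoc]
      exact ⟨_, hn.trans hm⟩
    | neg g _ ih =>
      intro X
      obtain ⟨n, hn⟩ := ih (X + ↑(-g))
      rw [QuotientAddGroup.mk_neg, neg_add_cancel_right] at hn
      exact ⟨n, hn.symm LineAdj.symm⟩
  induction X using QuotientAddGroup.induction_on with
  | H x =>
  induction Y using QuotientAddGroup.induction_on with
  | H y =>
  obtain ⟨n, hn⟩ := key (y - x) x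
  rw [← QuotientAddGroup.mk_add, add_sub_cancel] at hn
  exact ⟨n, hn⟩

theorem exists_ray_lineAdj {S : Finset Γ} {a b : Γ} (hbS : b ∈ S) (hab : Independent a b)
    (X : Γ ⧸ AddSubgroup.zmultiples a) :
    ∃ f : ℕ → Γ ⧸ AddSubgroup.zmultiples a, f 0 = X ∧ Function.Injective f ∧
      ∀ k, LineAdj S a (f k) (f (k + 1)) := by
  refine ⟨fun n => X + ↑(n • b), by simp, fun m n h => ?_, fun k =>
    ⟨b, hbS, hab.right_notMem, .inl ?_⟩⟩
  · obtain ⟨k, hk⟩ := mk_eq_iff_exists.1 (add_left_cancel h)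
    have := hab k (m - n) (by
      rw [sub_smul, natCast_zsmul, natCast_zsmul, hk]; abel)
    omega
  · simp only
    rw [succ_nsmul, QuotientAddGroup.mk_add, add_assoc]

/-- A line that meets no recoloured edge still lies within one component, which then has the two
ends of this line. -/
theorem finite_setOf_crossing {S : Finset Γ} {c : Γ × Γ → Γ} (hc : {e | c e ≠ e.2}.Finite) {a : Γ}
    (haS : a ∈ S) {M : LineEnd a → LineEnd a} (hM : Represents S c a M) :
    {X | M (X, true) ≠ (X, false)}.Finite := by
  refine ((hc.edgeEnds).image (QuotientAddGroup.mk (s := AddSubgroup.zmultiples a))).subset ?_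
  intro X hX
  by_contra hXB
  apply hX
  induction X using QuotientAddGroup.induction_on with
  | H x =>
  have hline : ∀ k : ℤ, c (x + k • a, a) = a := by
    intro k
    have : x + k • a ∉ edgeEnds {e | c e ≠ e.2} := fun h =>
      hXB ⟨_, h, mk_add_zsmul a x k⟩
    simpa using notMem_of_fst_notMem_edgeEnds (g := a) this
  have h1 : Touches S c a x (↑x, true) := by
    rw [touches_mk]
    filter_upwards [eventually_beyond true 0] with n hn
    simpa using colourConn_line (S := S) (c := c) haS hn fun k _ _ => hline k
  have h2 : Touches S c a x (↑x, false) := by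
    rw [touches_mk]
    filter_upwards [eventually_beyond false 0] with n hn
    simpa using (colourConn_line (S := S) (c := c) haS hn fun k _ _ => hline k).symm
  obtain ⟨p, hp⟩ := hM.2 x
  rw [hp] at h1 h2
  have := hM.1.invol p
  rcases h1 with h1 | h1 <;> rcases h2 with h2 | h2
  · rw [← h1] at h2; simp at h2
  · rw [h1, ← h2]
  · rw [h1, this, ← h2]
  · rw [← h1] at h2; simp at h2

/-- Two vertices can be joined in any colour, keeping the colours of finitely many edges. -/
theorem exists_valid_colourConn {S : Finset Γ} (hS : AddSubgroup.closure (S : Set Γ) = ⊤)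
    (hinf : ∀ g ∈ S, ¬ IsOfFinAddOrder g) (hind : ∀ a ∈ S, ∃ b ∈ S, Independent a b)
    {c : Γ × Γ → Γ} (hc : ValidColouring S c) {a : Γ} (haS : a ∈ S) {F : Set (Γ × Γ)}
    (hF : F.Finite) (v w : Γ) :
    ∃ c', ValidColouring S c' ∧ (∀ e ∈ F, c' e = c e) ∧ ColourConn S c' a v w := by
  obtain ⟨M, hM⟩ := hc.exists_matching a haS
  obtain ⟨p, hp⟩ := hM.1.2 v
  obtain ⟨q, hq⟩ := hM.1.2 w
  obtain ⟨b, hbS, hab⟩ := hind a haS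
  have hJ := joinable LineAdj.symm LineAdj.irrefl (exists_walk_lineAdj hS a)
    (exists_ray_lineAdj hbS hab) hM.1.1 hM.2 (finite_setOf_crossing hc.finite haS hM.1) p q
  exact exists_valid_colourConn_of_joinable hinf hind haS hF v w hJ c hc hM
    ((hp p).2 (.inl rfl)) ((hq q).2 (.inl rfl))

/-- A connection uses finitely many edges; freezing these makes it survive in the limit colouring.
-/
theorem ColourConn.exists_finite {S : Finset Γ} {c : Γ × Γ → Γ} {k u v : Γ}
    (h : ColourConn S c k u v) :
    ∃ F : Set (Γ × Γ), F.Finite ∧ ∀ c', (∀ e ∈ F, c' e = c e) → ColourConn S c' k u v := by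
  induction h with
  | rel u v h =>
    obtain ⟨g, hg, h, rfl⟩ := h
    exact ⟨{(u, g)}, Set.finite_singleton _, fun c' hc' =>
      .of_edge hg ((hc' _ rfl).trans h)⟩
  | refl u => exact ⟨∅, Set.finite_empty, fun _ _ => .refl _⟩
  | symm u v _ ih =>
    obtain ⟨F, hF, h⟩ := ih
    exact ⟨F, hF, fun c' hc' => (h c' hc').symm⟩
  | trans u v w _ _ ih ih' =>
    obtain ⟨F, hF, h⟩ := ih
    obtain ⟨F', hF', h'⟩ := ih'
    exact ⟨F ∪ F', hF.union hF', fun c' hc' =>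
      (h c' fun e he => hc' e (.inl he)).trans (h' c' fun e he => hc' e (.inr he))⟩

/-- The standard colouring is valid. -/
theorem validColouring_snd (S : Finset Γ) : ValidColouring S Prod.snd where
  finite := by simp
  mem _ he := he
  regular v k hk := by
    have : {h : Γ × Bool | h.1 ∈ S ∧ (halfEdge v h).2 = k} = {(k, true), (k, false)} := by
      ext ⟨g, s⟩
      cases s <;> simp [halfEdge] <;> (rintro rfl; exact hk)
    rw [this, Set.ncard_pair (by simp)]
  exists_matching a haS := by
    have hconn : ∀ u v, ColourConn S Prod.snd a u v ↔ ∃ k : ℤ, v = u + k • a := by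
      intro u v
      constructor
      · intro h
        rw [← mk_eq_iff_exists]
        induction h with
        | rel u v h =>
          obtain ⟨g, hg, rfl : g = a, rfl⟩ := h
          exact mk_eq_iff_exists.2 ⟨1, by rw [one_zsmul]⟩
        | refl u => rfl
        | symm u v _ ih => exact ih.symm
        | trans u v w _ _ ih ih' => exact ih.trans ih'
      · rintro ⟨k, rfl⟩
        rcases le_total 0 k with hk | hk
        · simpa using colourConn_line (S := S) (c := Prod.snd) (y := u) haS hk fun _ _ _ => rfl
        · simpa using
            (colourConn_line (S := S) (c := Prod.snd) (y := u) haS hk fun _ _ _ => rfl).symm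
    refine ⟨fun γ => (γ.1, !γ.2), ⟨⟨⟨fun γ => by simp, fun γ h => ?_⟩, fun v => ⟨(↑v, true), ?_⟩⟩,
      fun γ => ⟨0, ⟨fun _ => γ.1, rfl, rfl, by simp⟩, by simp⟩⟩⟩
    · simpa using (Prod.ext_iff.1 h).2
    · rintro ⟨X, s⟩
      induction X using QuotientAddGroup.induction_on with
      | H x =>
      have h1 : Touches S Prod.snd a v (↑x, s) ↔
          (v : Γ ⧸ AddSubgroup.zmultiples a) = x := by
        simp only [touches_mk, hconn, ← mk_eq_iff_exists, mk_add_zsmul, Filter.eventually_const]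
      rw [h1]
      cases s <;> simp [eq_comm]

/-- If no line is commensurable with all generators, then there is a colouring of the edges all of
whose classes are `2`-regular and connected. -/
theorem exists_hamiltonian_colouring [Countable Γ] {S : Finset Γ}
    (hS : AddSubgroup.closure (S : Set Γ) = ⊤)
    (hinf : ∀ g ∈ S, ¬ IsOfFinAddOrder g) (hind : ∀ a ∈ S, ∃ b ∈ S, Independent a b) :
    ∃ c : Γ × Γ → Γ, (∀ e : Γ × Γ, e.2 ∈ S → c e ∈ S) ∧
      (∀ v, ∀ k ∈ S, {h : Γ × Bool | h.1 ∈ S ∧ c (halfEdge v h) = k}.ncard = 2) ∧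
      ∀ k ∈ S, ∀ u v, ColourConn S c k u v := by
  classical
  -- A valid colouring together with the finite set of edges whose colours are frozen.
  let State := {σ : (Γ × Γ → Γ) × Set (Γ × Γ) // ValidColouring S σ.1 ∧ σ.2.Finite}
  have step : ∀ (τ : S × Γ × Γ) (σ : State), ∃ σ' : State, (∀ e ∈ σ.1.2, σ'.1.1 e = σ.1.1 e) ∧
      σ.1.2 ⊆ σ'.1.2 ∧ (∀ h : Γ × Bool, h.1 ∈ S → halfEdge τ.2.1 h ∈ σ'.1.2) ∧
      ∀ c', (∀ e ∈ σ'.1.2, c' e = σ'.1.1 e) → ColourConn S c' τ.1 τ.2.1 τ.2.2 := by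
    rintro ⟨⟨a, ha⟩, v, w⟩ ⟨⟨c, F⟩, hc, hF⟩
    obtain ⟨c', hc', hcc', hconn⟩ := exists_valid_colourConn hS hinf hind hc ha hF v w
    obtain ⟨F', hF', h'⟩ := hconn.exists_finite
    have hfin : (halfEdge v '' {h : Γ × Bool | h.1 ∈ S}).Finite := by
      refine Set.Finite.image _ ?_
      have : {h : Γ × Bool | h.1 ∈ S} = (S : Set Γ) ×ˢ Set.univ := by ext; simp
      rw [this]
      exact S.finite_toSet.prod Set.finite_univ
    refine ⟨⟨(c', F ∪ F' ∪ halfEdge v '' {h : Γ × Bool | h.1 ∈ S}), hc',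
      (hF.union hF').union hfin⟩, hcc', fun e he => .inl (.inl he), fun h hh => .inr ⟨h, hh, rfl⟩,
      fun d hd => h' d fun e he => hd e (.inl (.inr he))⟩
  choose next h1 h2 h3 h4 using step
  have start : State := ⟨(Prod.snd, ∅), validColouring_snd S, Set.finite_empty⟩
  rcases isEmpty_or_nonempty (S × Γ × Γ) with hE | hN
  · have : ∀ k, k ∉ S := fun k hk => hE.elim (⟨k, hk⟩, 0, 0)
    exact ⟨Prod.snd, fun e he => (this _ he).elim, fun v k hk => (this k hk).elim,
      fun k hk => (this k hk).elim⟩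
  obtain ⟨task, htask⟩ := exists_surjective_nat (S × Γ × Γ)
  let st : ℕ → State := fun n => Nat.rec start (fun n σ => next (task n) σ) n
  have hst : ∀ n, st (n + 1) = next (task n) (st n) := fun n => rfl
  have hmono : ∀ m n, m ≤ n → (st m).1.2 ⊆ (st n).1.2 ∧
      ∀ e ∈ (st m).1.2, (st n).1.1 e = (st m).1.1 e := by
    intro m n hmn
    induction n, hmn using Nat.le_induction with
    | base => exact ⟨subset_rfl, fun _ _ => rfl⟩
    | succ n _ ih =>
      rw [hst]
      exact ⟨ih.1.trans (h2 _ _), fun e he => (h1 _ _ e (ih.1 he)).trans (ih.2 e he)⟩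
  -- The limit colouring. The default `e.2` is never relevant for generators in S, because all edges
  -- at every vertex get frozen.
  let c : Γ × Γ → Γ := fun e => if h : ∃ n, e ∈ (st n).1.2 then (st h.choose).1.1 e else e.2
  have hc : ∀ n, ∀ e ∈ (st n).1.2, c e = (st n).1.1 e := by
    intro n e he
    have h : ∃ n, e ∈ (st n).1.2 := ⟨n, he⟩
    have : c e = (st h.choose).1.1 e := dif_pos h
    rw [this]
    rcases le_total n h.choose with hle | hle
    · exact (hmono _ _ hle).2 e he
    · exact ((hmono _ _ hle).2 e h.choose_spec).symm
  obtain ⟨⟨k₀, -, -⟩⟩ := hN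
  have hhalf : ∀ v, ∃ n, ∀ h : Γ × Bool, h.1 ∈ S → halfEdge v h ∈ (st n).1.2 := by
    intro v
    obtain ⟨n, hn⟩ := htask (k₀, v, v)
    refine ⟨n + 1, fun h hh => ?_⟩
    rw [hst]
    have := h3 (task n) (st n) h hh
    rwa [hn] at this ⊢
  refine ⟨c, fun e he => ?_, fun v k hk => ?_, fun k hk u v => ?_⟩
  · obtain ⟨n, hn⟩ := hhalf e.1
    rw [hc n e (hn (e.2, true) he)]
    exact (st n).2.1.mem e he
  · obtain ⟨n, hn⟩ := hhalf v
    rw [← (st n).2.1.regular v k hk]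
    congr 1
    ext h
    refine and_congr_right fun hh => ?_
    rw [hc n _ (hn h hh)]
  · obtain ⟨n, hn⟩ := htask (⟨k, hk⟩, u, v)
    have := h4 (task n) (st n) c (by rw [← hst]; exact hc (n + 1))
    rwa [hn] at this

end Existence

/-! ### From colour classes to Hamiltonian double-rays -/

section Decomposition

variable {Γ : Type*} [AddCommGroup Γ]

/-- The spanning subgraph of the Cayley multigraph which consists of the edges of colour `k`. -/
def colourSubgraph (S : Finset Γ) (c : Γ × Γ → Γ) (k : Γ) : Graph Γ (Γ × Γ) where
  vertexSet := Set.univ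
  IsLink e x y := c e = k ∧ (cayleyMultigraph S).IsLink e x y
  edgeSet := {e | e.2 ∈ S ∧ c e = k}
  isLink_symm := fun _ _ => ⟨fun _ _ h => ⟨h.1, h.2.symm⟩⟩
  eq_or_eq_of_isLink_of_isLink := fun _ _ _ _ _ h h' =>
    (cayleyMultigraph S).eq_or_eq_of_isLink_of_isLink h.2 h'.2
  edge_mem_iff_exists_isLink := fun e =>
    ⟨fun h => ⟨e.1, e.1 + e.2, h.2, h.1, Or.inl ⟨rfl, rfl⟩⟩, fun ⟨_, _, h⟩ => ⟨h.2.1, h.1⟩⟩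
  left_mem_of_isLink := fun _ _ _ _ => Set.mem_univ _

theorem halfEdge_injOn {S : Finset Γ} (h0 : (0 : Γ) ∉ S) (v : Γ) :
    Set.InjOn (halfEdge v) {h | h.1 ∈ S} := by
  rintro ⟨g, s⟩ hg ⟨g', t⟩ hg' h
  simp only [halfEdge, Prod.mk.injEq] at h
  obtain ⟨h, rfl⟩ := h
  have : g ≠ 0 := by rintro rfl; exact h0 hg
  cases s <;> cases t <;> simp_all [eq_sub_iff_add_eq]

/-- As 0 ∉ S there are no loops, and distinct half-edges at v belong to distinct edges. -/
theorem multigraphDegree_colourSubgraph {S : Finset Γ} (h0 : (0 : Γ) ∉ S) (c : Γ × Γ → Γ)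
    (k v : Γ) : multigraphDegree (colourSubgraph S c k) v =
      {h : Γ × Bool | h.1 ∈ S ∧ c (halfEdge v h) = k}.encard := by
  have hloop : {e | (colourSubgraph S c k).IsLoopAt e v} = ∅ := by
    ext e
    simp only [Set.mem_ofPred_eq, Set.mem_empty_iff_false, iff_false]
    rintro ⟨-, he, h⟩
    have : e.2 = 0 := by
      rcases h with ⟨h, h'⟩ | ⟨h, h'⟩ <;>
      · rw [← h] at h'
        exact left_eq_add.1 h'
    exact h0 (this ▸ he)
  have hnon : {e | (colourSubgraph S c k).IsNonloopAt e v} =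
      halfEdge v '' {h : Γ × Bool | h.1 ∈ S ∧ c (halfEdge v h) = k} := by
    ext ⟨x, g⟩
    constructor
    · rintro ⟨y, -, hc, hg, h⟩
      rcases h with ⟨h, -⟩ | ⟨-, h⟩
      · refine ⟨(g, true), ⟨hg, ?_⟩, ?_⟩ <;> simp only [halfEdge, cond_true]
        · rw [h]; exact hc
        · rw [h]
      · have hx : v - g = x := sub_eq_of_eq_add h
        refine ⟨(g, false), ⟨hg, ?_⟩, ?_⟩ <;> simp only [halfEdge, cond_false]
        · rw [hx]; exact hc
        · rw [hx]
    · rintro ⟨⟨g', s⟩, ⟨hg, hc⟩, h⟩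
      have hg0 : g' ≠ 0 := fun h => h0 (h ▸ hg)
      cases s <;> simp only [halfEdge, cond_true, cond_false, Prod.mk.injEq] at h hc
      · obtain ⟨rfl, rfl⟩ := h
        exact ⟨v - g', by simpa using hg0, hc, hg, .inr ⟨rfl, by simp⟩⟩
      · obtain ⟨rfl, rfl⟩ := h
        exact ⟨v + g', by simpa using hg0, hc, hg, .inl ⟨rfl, rfl⟩⟩
  rw [multigraphDegree, hloop, hnon, Set.InjOn.encard_image]
  · simp
  · exact (halfEdge_injOn h0 v).mono fun h hh => hh.1

theorem colourSubgraph_connected {S : Finset Γ} {c : Γ × Γ → Γ} {k : Γ}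
    (h : ∀ u v, ColourConn S c k u v) : IsConnectedMultigraph (colourSubgraph S c k) := by
  have key : ∀ u v, ColourConn S c k u v →
      (colourSubgraph S c k).toSimpleGraph.Reachable ⟨u, Set.mem_univ u⟩ ⟨v, Set.mem_univ v⟩ := by
    intro u v h
    induction h with
    | rel u v h =>
      obtain ⟨g, hg, hc, rfl⟩ := h
      by_cases hne : u = u + g
      · simp only [← hne]
        exact .refl _
      · refine SimpleGraph.Adj.reachable ⟨fun h => hne (Subtype.ext_iff.1 h), (u, g), hc, hg, ?_⟩
        exact .inl ⟨rfl, rfl⟩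
    | refl u => exact .refl _
    | symm u v _ ih => exact ih.symm
    | trans u v w _ _ ih ih' => exact ih.trans ih'
  have : Nonempty V(colourSubgraph S c k) := ⟨⟨0, Set.mem_univ _⟩⟩
  exact ⟨fun u v => key u v (h u v)⟩

/-- The classes of a colouring all of whose classes are `2`-regular and connected form a Hamilton
decomposition. -/
theorem isHamiltonDecomposition_of_colouring [Infinite Γ] {S : Finset Γ} (h0 : (0 : Γ) ∉ S)
    {c : Γ × Γ → Γ} (hmem : ∀ e : Γ × Γ, e.2 ∈ S → c e ∈ S)
    (hreg : ∀ v, ∀ k ∈ S, {h : Γ × Bool | h.1 ∈ S ∧ c (halfEdge v h) = k}.ncard = 2)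
    (hconn : ∀ k ∈ S, ∀ u v, ColourConn S c k u v) :
    IsHamiltonDecomposition (cayleyMultigraph S) (colourSubgraph S c '' S) ∧
      (colourSubgraph S c '' (S : Set Γ)).encard = S.card := by
  refine ⟨⟨?_, fun e he => ?_⟩, ?_⟩
  · rintro _ ⟨k, hk, rfl⟩
    refine ⟨⟨⟨subset_rfl, fun e x y h => h.2⟩, rfl⟩, Set.infinite_univ,
      colourSubgraph_connected (hconn k hk), fun v _ => ?_⟩
    rw [multigraphDegree_colourSubgraph h0]
    have hfin := Set.finite_of_ncard_ne_zero (by rw [hreg v k hk]; exact two_ne_zero)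
    rw [← hfin.cast_ncard_eq, hreg v k hk]
    rfl
  · refine ⟨colourSubgraph S c (c e), ⟨⟨c e, hmem e he, rfl⟩, he, rfl⟩, ?_⟩
    rintro _ ⟨⟨k, hk, rfl⟩, he'⟩
    rw [he'.2]
  · rw [Set.InjOn.encard_image, Set.encard_coe_eq_coe_finsetCard]
    intro k hk l hl h
    have hne : {h : Γ × Bool | h.1 ∈ S ∧ c (halfEdge 0 h) = k}.Nonempty :=
      Set.nonempty_of_ncard_ne_zero (by rw [hreg 0 k hk]; exact two_ne_zero)
    obtain ⟨x, hx, hxk⟩ := hne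
    have h1 : halfEdge 0 x ∈ E(colourSubgraph S c k) := ⟨hx, hxk⟩
    rw [h] at h1
    exact hxk.symm.trans h1.2

end Decomposition

/-! ### Ends of the graph and commensurable generators -/

section Ends

/-- After a ray has left K for good, it stays in a single component of the complement; these
components are compatible and form an end. -/
theorem exists_end_of_ray {V : Type*} (G : SimpleGraph V) {r : ℕ → V} (hr : Function.Injective r)
    (hadj : ∀ n, G.Adj (r n) (r (n + 1))) :
    ∃ C : ∀ K : Finset V, G.ComponentCompl K, (fun K : (Finset V)ᵒᵖ => C K.unop) ∈ G.end ∧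
      ∀ K, ∀ᶠ n in Filter.atTop, r n ∈ C K := by
  have key : ∀ K : Finset V, ∃ C : G.ComponentCompl K, ∀ᶠ n in Filter.atTop, r n ∈ C := by
    intro K
    have hK : ∀ᶠ n in Filter.atTop, r n ∉ (K : Set V) := by
      have : (r ⁻¹' K).Finite := K.finite_toSet.preimage hr.injOn
      rw [← Nat.cofinite_eq_atTop]
      exact this.compl_mem_cofinite
    obtain ⟨N, hN⟩ := Filter.eventually_atTop.1 hK
    refine ⟨G.componentComplMk (hN N le_rfl), Filter.eventually_atTop.2 ⟨N, fun n hn => ?_⟩⟩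
    induction n, hn using Nat.le_induction with
    | base => exact ⟨_, rfl⟩
    | succ n hn ih =>
      obtain ⟨h, e⟩ := ih
      exact ⟨hN _ (hn.trans (Nat.le_succ n)),
        (G.componentComplMk_eq_of_adj _ _ (hadj n).symm).trans e⟩
  choose C hC using key
  refine ⟨C, fun {K L} f => ?_, hC⟩
  obtain ⟨n, h1, h2⟩ := ((hC K.unop).and (hC L.unop)).exists
  have h3 := SimpleGraph.ComponentCompl.subset_hom (C K.unop) (CategoryTheory.le_of_op_hom f) h1
  obtain ⟨_, e⟩ := h2
  obtain ⟨_, e'⟩ := h3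
  exact e'.symm.trans e

variable {Γ : Type*} [AddCommGroup Γ]

/-- The rays of positive and of negative multiples of a are separated by the finite set where |φ| is
small. -/
theorem not_isOneEnded_of_hom {S : Finset Γ} (φ : Γ →+ ℤ) (hφ : ∀ L : ℤ, {x | |φ x| ≤ L}.Finite)
    {a : Γ} (haS : a ∈ S) (ha : 0 < φ a) : ¬ IsOneEnded (cayleyMultigraph S) := by
  rintro ⟨ε, -, huniq⟩
  set G := (cayleyMultigraph S).toSimpleGraph with hG
  have hinj : Function.Injective fun n : ℤ => n • a := by
    intro m n h
    have : φ (m • a) = φ (n • a) := congrArg φ h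
    simpa [ha.ne'] using this
  let p : Γ → V(cayleyMultigraph S) := fun x => ⟨x, Set.mem_univ x⟩
  have hstep : ∀ n : ℤ, G.Adj (p (n • a)) (p ((n + 1) • a)) := by
    intro n
    refine ⟨fun h => ?_, (n • a, a), haS, .inl ⟨rfl, ?_⟩⟩
    · have := hinj (Subtype.ext_iff.1 h)
      omega
    · simp only [p]
      rw [add_zsmul, one_zsmul]
  obtain ⟨ε₁, h₁, hr₁⟩ := exists_end_of_ray G (r := fun n : ℕ => p ((n : ℤ) • a))
    (fun m n h => by exact_mod_cast hinj (Subtype.ext_iff.1 h))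
    (fun n => by simpa using hstep n)
  obtain ⟨ε₂, h₂, hr₂⟩ := exists_end_of_ray G (r := fun n : ℕ => p ((-n : ℤ) • a))
    (fun m n h => by
      have := hinj (Subtype.ext_iff.1 h)
      omega)
    (fun n => by
      have := (hstep (-(n + 1))).symm
      rw [show (-((n : ℤ) + 1) + 1) = -n by ring] at this
      exact_mod_cast this)
  have heq : ∀ K, ε₁ K = ε₂ K := fun K =>
    congrFun ((huniq _ h₁).trans (huniq _ h₂).symm) (.op K)
  -- An edge changes φ by at most L, so it cannot pass from above L to below -L; outside K the sign
  -- of φ is constant on components.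
  let L : ℤ := ∑ g ∈ S, |φ g|
  have hL : ∀ g ∈ S, |φ g| ≤ L := fun g hg =>
    Finset.single_le_sum (f := fun g => |φ g|) (fun _ _ => abs_nonneg _) hg
  have hfin : {x : V(cayleyMultigraph S) | |φ x.1| ≤ L}.Finite :=
    Set.Finite.preimage (f := Subtype.val) Subtype.val_injective.injOn (hφ L)
  let K := hfin.toFinset
  have hK : ∀ v : V(cayleyMultigraph S), v ∉ (K : Set _) ↔ L < |φ v.1| := by
    intro v
    simp [K]
  have hsign : ∀ ⦃v w : V(cayleyMultigraph S)⦄, v ∉ (K : Set _) → w ∉ (K : Set _) → G.Adj v w →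
      decide (0 < φ v.1) = decide (0 < φ w.1) := by
    rintro ⟨v, _⟩ ⟨w, _⟩ hv hw ⟨-, e, he, h⟩
    rw [hK, lt_abs] at hv hw
    have := abs_le.1 (hL e.2 he)
    rw [decide_eq_decide]
    rcases h with ⟨rfl, rfl⟩ | ⟨rfl, rfl⟩ <;> simp only [map_add] at * <;> omega
  obtain ⟨n, ⟨hv, ev⟩, ⟨hw, ew⟩, hn⟩ := ((hr₁ K).and
    ((hr₂ K).and (Filter.eventually_gt_atTop 0))).exists
  have h := congrArg (SimpleGraph.ComponentCompl.lift
    (fun v _ => decide (0 < φ v.1)) hsign) (ev.trans ((heq K).trans ew.symm))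
  have h' : decide (0 < φ ((n : ℤ) • a)) = decide (0 < φ ((-n : ℤ) • a)) := h
  rw [decide_eq_decide, map_zsmul, map_zsmul, smul_eq_mul, smul_eq_mul] at h'
  have : (0 : ℤ) < n * φ a := by positivity
  have := h'.1 this
  linarith

/-- If all generators are commensurable with `a`, then there is a homomorphism to `ℤ` with finite
fibres. -/
theorem exists_hom_of_commensurable [AddGroup.FG Γ] {S : Finset Γ}
    (hS : AddSubgroup.closure (S : Set Γ) = ⊤) {a : Γ} (ha : ¬ IsOfFinAddOrder a)
    (h : ∀ b ∈ S, ¬ Independent a b) :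
    ∃ φ : Γ →+ ℤ, (∀ L : ℤ, {x | |φ x| ≤ L}.Finite) ∧ 0 < φ a := by
  have htor : IsAddTorsion (Γ ⧸ AddSubgroup.zmultiples a) := by
    have key : ∀ x : Γ, IsOfFinAddOrder (x : Γ ⧸ AddSubgroup.zmultiples a) := by
      intro x
      have hx : x ∈ AddSubgroup.closure (S : Set Γ) := hS ▸ AddSubgroup.mem_top x
      induction hx using AddSubgroup.closure_induction with
      | mem b hb =>
        have := h b hb
        unfold Independent at this
        push Not at this
        obtain ⟨m, n, hmn, h0⟩ := this
        have hn : n ≠ 0 := by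
          rintro rfl
          rw [zero_zsmul, add_zero] at hmn
          exact h0 (zsmul_eq_zero_of_infinite ha hmn) rfl
        refine isOfFinAddOrder_iff_zsmul_eq_zero.2 ⟨n, hn, ?_⟩
        rw [← QuotientAddGroup.mk_zsmul, QuotientAddGroup.eq_zero_iff]
        refine AddSubgroup.mem_zmultiples_iff.2 ⟨-m, ?_⟩
        rw [neg_zsmul, eq_comm]
        exact eq_neg_of_add_eq_zero_right hmn
      | zero => exact .zero
      | add x y _ _ hx hy => exact hx.add hy
      | neg x _ hx => exact hx.neg
    rintro X
    induction X using QuotientAddGroup.induction_on with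
    | H x => exact key x
  have hfin : Finite (Γ ⧸ AddSubgroup.zmultiples a) :=
    AddCommGroup.finite_of_fg_isAddTorsion _ htor
  set N := Nat.card (Γ ⧸ AddSubgroup.zmultiples a) with hN
  have hN0 : 0 < N := Nat.card_pos
  -- The index N of ⟨a⟩ sends Γ into ⟨a⟩ ≅ ℤ; reading off the coefficient gives φ, with φ a = N.
  have hex : ∀ x : Γ, ∃ k : ℤ, k • a = N • x := by
    intro x
    rw [← AddSubgroup.mem_zmultiples_iff, ← QuotientAddGroup.eq_zero_iff,
      QuotientAddGroup.mk_nsmul]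
    exact card_nsmul_eq_zero'
  choose f hf using hex
  let φ : Γ →+ ℤ := AddMonoidHom.mk' f fun x y => zsmul_inj_of_infinite ha <| by
    rw [hf, add_zsmul, hf, hf, nsmul_add]
  have hφ : ∀ x, φ x • a = N • x := hf
  refine ⟨φ, fun L => ?_, ?_⟩
  · refine Set.Finite.of_finite_image (f := fun x : Γ =>
      ((x : Γ ⧸ AddSubgroup.zmultiples a), φ x)) ?_ ?_
    · refine (Set.finite_univ.prod (Set.finite_Icc (-L) L)).subset ?_
      rintro _ ⟨x, hx, rfl⟩
      exact ⟨Set.mem_univ _, abs_le.1 hx⟩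
    · intro x _ y _ hxy
      simp only [Prod.mk.injEq] at hxy
      obtain ⟨k, rfl⟩ := mk_eq_iff_exists.1 hxy.1
      have h1 : φ (k • a) = 0 := by
        have := hxy.2
        rw [map_add] at this
        omega
      have h2 := hφ (k • a)
      rw [h1, zero_zsmul, ← natCast_zsmul, ← mul_zsmul] at h2
      have h3 := zsmul_eq_zero_of_infinite ha h2.symm
      have h4 : k = 0 := by
        rcases mul_eq_zero.1 h3 with h | h
        · omega
        · exact h
      rw [h4, zero_zsmul, add_zero]
  · have := hφ a
    rw [← natCast_zsmul] at this
    have := zsmul_inj_of_infinite ha this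
    omega

end Ends

theorem countable_of_addGroup_fg (Γ : Type*) [AddCommGroup Γ] [h : AddGroup.FG Γ] :
    Countable Γ := by
  have : Module.Finite ℤ Γ := Module.Finite.iff_addGroup_fg.2 h
  obtain ⟨n, f, hf⟩ := Module.Finite.exists_fin' ℤ Γ
  exact hf.countable

theorem exists_isHamiltonDecomposition {Γ : Type*} [AddCommGroup Γ] [Infinite Γ] [Countable Γ]
    {S : Finset Γ} (hS : AddSubgroup.closure (S : Set Γ) = ⊤)
    (hinf : ∀ g ∈ S, ¬ IsOfFinAddOrder g) (hind : ∀ a ∈ S, ∃ b ∈ S, Independent a b) :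
    ∃ 𝓓 : Set (Graph Γ (Γ × Γ)), 𝓓.encard = S.card ∧
      IsHamiltonDecomposition (cayleyMultigraph S) 𝓓 := by
  obtain ⟨c, h1, h2, h3⟩ := exists_hamiltonian_colouring hS hinf hind
  obtain ⟨h, h'⟩ := isHamiltonDecomposition_of_colouring
    (fun h0 => hinf 0 h0 .zero) h1 h2 h3
  exact ⟨_, h', h⟩

/-! ### The standard generators of ℤⁿ -/

section StandardGenerators

variable {n : ℕ}

theorem card_standardGenerators (n : ℕ) : (standardGenerators n).card = n := by
  rw [standardGenerators, Finset.card_image_of_injective, Finset.card_univ, Fintype.card_fin]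
  intro i j h
  by_contra hne
  have := congrFun h i
  simp [hne] at this

theorem closure_standardGenerators (n : ℕ) :
    AddSubgroup.closure (standardGenerators n : Set (Fin n → ℤ)) = ⊤ := by
  refine eq_top_iff.2 fun x _ => ?_
  rw [← Finset.univ_sum_single x]
  refine sum_mem fun i _ => ?_
  have : Pi.single i (x i) = x i • (Pi.single i 1 : Fin n → ℤ) := by
    rw [← Pi.single_smul]; simp
  rw [this]
  exact zsmul_mem (AddSubgroup.subset_closure (by simp [standardGenerators])) _

theorem not_isOfFinAddOrder_of_mem_standardGenerators :
    ∀ g ∈ standardGenerators n, ¬ IsOfFinAddOrder g := by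
  intro g hg h
  obtain ⟨i, -, rfl⟩ := Finset.mem_image.1 hg
  obtain ⟨k, hk, h⟩ := isOfFinAddOrder_iff_zsmul_eq_zero.1 h
  have := congrFun h i
  simp at this
  exact hk this

theorem independent_of_mem_standardGenerators (hn : 2 ≤ n) :
    ∀ a ∈ standardGenerators n, ∃ b ∈ standardGenerators n, Independent a b := by
  intro a ha
  obtain ⟨i, -, rfl⟩ := Finset.mem_image.1 ha
  have : Nontrivial (Fin n) := Fin.nontrivial_iff_two_le.2 hn
  obtain ⟨j, hj⟩ := exists_ne i
  refine ⟨Pi.single j 1, by simp [standardGenerators], fun k l h => ?_⟩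
  have h1 := congrFun h i
  have h2 := congrFun h j
  simp [hj, hj.symm] at h1 h2
  exact ⟨h1, h2⟩

theorem colourConn_standardGenerators_one :
    ∀ k ∈ standardGenerators 1, ∀ u v, ColourConn (standardGenerators 1) Prod.snd k u v := by
  intro k hk
  have key : ∀ u : Fin 1 → ℤ, ∀ m : ℤ, 0 ≤ m →
      ColourConn (standardGenerators 1) Prod.snd k u (u + m • k) := by
    intro u m hm
    simpa using colourConn_line (S := standardGenerators 1) (c := Prod.snd) (y := u) hk hm
      fun _ _ _ => rfl
  have huv : ∀ u v : Fin 1 → ℤ, v = u + (v 0 - u 0) • k := by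
    intro u v
    obtain ⟨i, -, rfl⟩ := Finset.mem_image.1 hk
    ext j
    obtain rfl := Subsingleton.elim i 0
    obtain rfl := Subsingleton.elim j 0
    simp
  intro u v
  rcases le_total (u 0) (v 0) with h | h
  · rw [huv u v]
    exact key u _ (by omega)
  · rw [huv v u]
    exact (key v _ (by omega)).symm

end StandardGenerators

theorem theorem1p1 :
    (∀ (Γ : Type*) [AddCommGroup Γ] [Infinite Γ] [AddGroup.FG Γ] (S : Finset Γ),
      AddSubgroup.closure (S : Set Γ) = ⊤ →
      (∀ g ∈ S, ¬ IsOfFinAddOrder g) →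
      IsOneEnded (cayleyMultigraph S) →
      HasHamiltonDecomposition (cayleyMultigraph S)) ∧
    (∀ n : ℕ, 1 ≤ n →
      ∃ 𝓓 : Set (Graph (Fin n → ℤ) ((Fin n → ℤ) × (Fin n → ℤ))),
        𝓓.encard = n ∧
        IsHamiltonDecomposition (cayleyMultigraph (standardGenerators n)) 𝓓) := by
  refine ⟨fun Γ _ _ _ S hS hinf hone => ?_, fun n hn => ?_⟩
  · have := countable_of_addGroup_fg Γ
    have hind : ∀ a ∈ S, ∃ b ∈ S, Independent a b := by
      intro a ha
      by_contra! h
      obtain ⟨φ, hφ, hpos⟩ := exists_hom_of_commensurable hS (hinf a ha) h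
      exact not_isOneEnded_of_hom φ hφ ha hpos hone
    obtain ⟨𝓓, -, h⟩ := exists_isHamiltonDecomposition hS hinf hind
    exact ⟨𝓓, h⟩
  · have : Nonempty (Fin n) := ⟨⟨0, hn⟩⟩
    have hinf := not_isOfFinAddOrder_of_mem_standardGenerators (n := n)
    rcases hn.eq_or_lt with rfl | hn
    · have hvalid := validColouring_snd (standardGenerators 1)
      have := isHamiltonDecomposition_of_colouring (fun h0 => hinf 0 h0 .zero) hvalid.mem
        hvalid.regular colourConn_standardGenerators_one
      rw [card_standardGenerators] at this
      exact ⟨_, this.2, this.1⟩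
    · obtain ⟨𝓓, h, h'⟩ := exists_isHamiltonDecomposition (closure_standardGenerators n) hinf
        (independent_of_mem_standardGenerators hn)
      exact ⟨𝓓, by rw [h, card_standardGenerators], h'⟩
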